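/- Let $n\ge 1$ be an integer. For $s>0$ let $$L_s(\mathbb{R}^n)=\Big\{v\in L^1_{loc}(\mathbb{R}^n):\ \int_{\mathbb{R}^n}\frac{|v(x)|}{1+|x|^{n+2s}}\,dx<\infty\Big\},$$ and for $\varphi$ in the Schwartz space $\mathcal{S}(\mathbb{R}^n)$ let $(-\Delta)^s\varphi$ be the function with Fourier transform $|\xi|^{2s}\hat\varphi(\xi)$, where $\hat\varphi(\xi)=(2\pi)^{-n/2}\int_{\mathbb{R}^n}\varphi(x)e^{-ix\cdot\xi}\,dx$. Let $u:\mathbb{R}^n\to\mathbb{R}$ be a function with $\int_{\mathbb{R}^n}e^{nu}\,dx<\infty$ which solves $$(-\Delta)^{n/2}u=(n-1)!\,e^{nu}\quad\text{in }\mathbb{R}^n$$ in one of the following two senses: (a) $u\in L_{n/2}(\mathbb{R}^n)$ and $$\int_{\mathbb{R}^n}u\,(-\Delta)^{n/2}\varphi\,dx=(n-1)!\int_{\mathbb{R}^n}e^{nu}\varphi\,dx\quad\text{for every }\varphi\in\mathcal{S}(\mathbb{R}^n);$$ (b) $n$ is odd, $u\in W^{n-1,1}_{loc}(\mathbb{R}^n)$,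 the weak derivative $\Delta^{\frac{n-1}{2}}u$ belongs to $L_{1/2}(\mathbb{R}^n)$, and $$\int_{\mathbb{R}^n}(-\Delta)^{\frac{n-1}{2}}u\,(-\Delta)^{1/2}\varphi\,dx=(n-1)!\int_{\mathbb{R}^n}e^{nu}\varphi\,dx\quad\text{for every }\varphi\in\mathcal{S}(\mathbb{R}^n).$$ Then $u$ is smooth, that is, $u$ coincides almost everywhere with a function in $C^\infty(\mathbb{R}^n)$. -/

import Mathlib

open MeasureTheory
open scoped FourierTransform SchwartzMap ContDiff Laplacian

noncomputable section

namespace ConformalQ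

/-- `ℝⁿ` with its Euclidean norm. -/
abbrev Rn (n : ℕ) : Type := EuclideanSpace ℝ (Fin n)

/-- The space `L_s(ℝⁿ)`: locally integrable functions `v` with
`∫ |v(x)| / (1 + |x|^(n+2s)) dx < ∞`. -/
def MemL {n : ℕ} (s : ℝ) (v : Rn n → ℝ) : Prop :=
  LocallyIntegrable v volume ∧
    Integrable (fun x : Rn n => |v x| / (1 + ‖x‖ ^ ((n : ℝ) + 2 * s))) volume

/-- The fractional Laplacian `(-Δ)^s φ` of a Schwartz function, i.e. the Fourier multiplier with
symbol `|ξ|^(2s)` for the Fourier transform with kernel `e^{-i x·ξ}`. Mathlib's Fourier transform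
has the kernel `e^{-2π i x·ξ}`, so that the symbol becomes `(2π|ξ|)^(2s)`. -/
def fracLaplacian {n : ℕ} (s : ℝ) (φ : 𝓢(Rn n, ℂ)) : Rn n → ℂ :=
  𝓕⁻ (fun ξ : Rn n => (((2 * Real.pi * ‖ξ‖) ^ (2 * s) : ℝ) : ℂ) * 𝓕 (φ : Rn n → ℂ) ξ)

/-- Test functions: real functions in `C_c^∞(ℝⁿ)`. -/
def IsTest {n : ℕ} (φ : Rn n → ℝ) : Prop :=
  ContDiff ℝ ∞ φ ∧ HasCompactSupport φ

/-- `g` is the weak derivative `∂_{i 0} ⋯ ∂_{i (k-1)} u` in the coordinate directions listed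
by `i`. -/
def HasWeakPartial {n k : ℕ} (i : Fin k → Fin n) (u g : Rn n → ℝ) : Prop :=
  ∀ φ : Rn n → ℝ, IsTest φ →
    ∫ x, u x * iteratedFDeriv ℝ k φ x (fun j => EuclideanSpace.single (i j) (1 : ℝ)) =
      (-1) ^ k * ∫ x, g x * φ x

/-- The local Sobolev space `W^{k,1}_loc(ℝⁿ)`: all weak partial derivatives up to order `k`
(order `0` being `u` itself) exist in `L¹_loc(ℝⁿ)`. -/
def MemW1loc {n : ℕ} (k : ℕ) (u : Rn n → ℝ) : Prop :=
  LocallyIntegrable u volume ∧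
    ∀ j ≤ k, ∀ i : Fin j → Fin n,
      ∃ g : Rn n → ℝ, LocallyIntegrable g volume ∧ HasWeakPartial i u g

/-- `w = Δ^m u` in the weak sense. -/
def HasWeakLaplacianPow {n : ℕ} (m : ℕ) (u w : Rn n → ℝ) : Prop :=
  ∀ φ : Rn n → ℝ, IsTest φ →
    ∫ x, u x * ((fun ψ : Rn n → ℝ => Δ ψ)^[m] φ) x = ∫ x, w x * φ x

/-- `u` solves `(-Δ)^(n/2) u = f` in the distributional sense: `u ∈ L_{n/2}(ℝⁿ)` and
`∫ u (-Δ)^(n/2) φ dx = ⟨f, φ⟩` for every Schwartz function `φ`. -/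
def IsDistributionalSolution {n : ℕ} (u : Rn n → ℝ) (f : 𝓢'(Rn n, ℂ)) : Prop :=
  MemL ((n : ℝ) / 2) u ∧
    ∀ φ : 𝓢(Rn n, ℂ), ∫ x, (u x : ℂ) * fracLaplacian ((n : ℝ) / 2) φ x = f φ

/-- For odd `n`: `u` solves `(-Δ)^(n/2) u = f` in the Sobolev sense: `u ∈ W^{n-1,1}_loc(ℝⁿ)`,
the weak derivative `w = Δ^((n-1)/2) u` lies in `L_{1/2}(ℝⁿ)`, and
`∫ (-Δ)^((n-1)/2) u (-Δ)^(1/2) φ dx = ⟨f, φ⟩` for every Schwartz function `φ`. -/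
def IsSobolevSolution {n : ℕ} (u : Rn n → ℝ) (f : 𝓢'(Rn n, ℂ)) : Prop :=
  MemW1loc (n - 1) u ∧
    ∃ w : Rn n → ℝ, HasWeakLaplacianPow ((n - 1) / 2) u w ∧ MemL (1 / 2) w ∧
      ∀ φ : 𝓢(Rn n, ℂ),
        ∫ x, (((-1) ^ ((n - 1) / 2) * w x : ℝ) : ℂ) * fracLaplacian (1 / 2) φ x = f φ

/-- The tempered distribution `φ ↦ ∫ g φ dx` of an integrable function `g`. -/
def distributionOf {n : ℕ} (g : Rn n → ℝ) (hg : Integrable g volume) : 𝓢'(Rn n, ℂ) :=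
  Lp.toTemperedDistribution (hg.ofReal (𝕜 := ℂ)).toL1

theorem distributionOf_apply {n : ℕ} (g : Rn n → ℝ) (hg : Integrable g volume)
    (φ : 𝓢(Rn n, ℂ)) : distributionOf g hg φ = ∫ x, (g x : ℂ) * φ x := by
  rw [distributionOf, Lp.toTemperedDistribution_apply]
  refine integral_congr_ae ?_
  filter_upwards [(hg.ofReal (𝕜 := ℂ)).coeFn_toL1] with x hx
  rw [hx, smul_eq_mul, mul_comm]
  rfl

/-- A function, as a class modulo null sets, is smooth: it agrees almost everywhere with a
`C^∞` function. -/
def IsSmooth {n : ℕ} (u : Rn n → ℝ) : Prop :=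
  ∃ v : Rn n → ℝ, ContDiff ℝ ∞ v ∧ u =ᵐ[volume] v

end ConformalQ

end

namespace ConformalQ

variable {n : ℕ}

/-! Write `f = (n-1)! e^{nu}`. The equation is inverted modulo smooth functions by a parametrix. Let
`K` be the kernel with symbol `|2πξ|^{-n}(1 - cutoff ξ)` and `ρ` the Schwartz function with symbol
`cutoff`. For a test function `ψ`, `K * ψ` is Schwartz and `(-Δ)^{n/2}(K * ψ) = ψ - ρ * ψ`. Testing
the equation with `K * ψ` gives `u = ρ * u + K * f` almost everywhere, and `ρ * u` is smooth because
`u` has at most the growth allowed in `L_{n/2}` (`exists_contDiff_add_conv`). In sense (b), with `n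
= 2k + 1`, the same argument represents `(-Δ)^k u` by the kernel of order `1`. Then `Δ^k (u - K *
f)` is weakly a smooth function, and a Weyl lemma for `Δ^k`
(`exists_contDiff_of_weak_laplacian_iterate`) makes `u - K * f` smooth. Both senses thus lead to `u
= S + K * f` with `S` smooth.

A dyadic decomposition of the symbol shows that `K` is integrable, smooth off the origin, at most
logarithmic at the origin, and that its Fourier transform is `O((1 + |ξ|)^{-n})`
(`isLogKernel_highKernel`). A Brezis–Merle argument starts the regularity: the part of `f` above a
high level has small mass, so Jensen's inequality makes the exponential of its potential locally
integrable; the rest of `f` is bounded and has a bounded potential. Hence `f` is locally in `L²`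
(`IsLogKernel.integrableOn_sq`). The transforms of `K` and of a truncation of `f` are then both in
`L²`, their product is in `L¹`, and `u` is locally the inverse Fourier transform of an `L¹`
function.

The bootstrap takes place in the Wiener algebras with weight `(1 + |ξ|)^s`. They are Banach
algebras, so the exponential acts on them locally, and convolution with `K` raises `s` by `n`.
Iterating gives every order (`IsLogKernel.isSmooth_of_eq_add_conv_exp`). -/

theorem integrable_tsum_of_summable_integral_norm {α E : Type*} [MeasurableSpace α]
    {μ : Measure α} [NormedAddCommGroup E] [CompleteSpace E] {F : ℕ → α → E}
    (hF : ∀ i, Integrable (F i) μ) (hs : Summable fun i => ∫ x, ‖F i x‖ ∂μ) :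
    Integrable (fun x => ∑' i, F i x) μ ∧ (∀ᵐ x ∂μ, Summable fun i => ‖F i x‖) ∧
      Integrable (fun x => ∑' i, ‖F i x‖) μ := by
  have hlt : ∫⁻ x, ∑' i, ‖F i x‖ₑ ∂μ < ⊤ := by
    rw [lintegral_tsum fun i => (hF i).1.enorm]
    have : ∀ i, ∫⁻ x, ‖F i x‖ₑ ∂μ = ENNReal.ofReal (∫ x, ‖F i x‖ ∂μ) := fun i =>
      (ofReal_integral_norm_eq_lintegral_enorm (hF i)).symm
    simp_rw [this]
    rw [← ENNReal.ofReal_tsum_of_nonneg (fun i => integral_nonneg fun x => norm_nonneg _) hs]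
    exact ENNReal.ofReal_lt_top
  have hae : ∀ᵐ x ∂μ, Summable fun i => ‖F i x‖ := by
    filter_upwards [ae_lt_top' (AEMeasurable.tsum fun i => (hF i).1.enorm) hlt.ne] with x hx
    have := ENNReal.tsum_coe_ne_top_iff_summable.1 hx.ne
    exact NNReal.summable_coe.2 this
  have hm : AEStronglyMeasurable (fun x => ∑' i, F i x) μ := by
    refine aestronglyMeasurable_of_tendsto_ae Filter.atTop
      (f := fun N x => ∑ i ∈ Finset.range N, F i x)
      (fun N => Finset.aestronglyMeasurable_fun_sum _ fun i _ => (hF i).1) ?_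
    filter_upwards [hae] with x hx
    exact (Summable.of_norm hx).hasSum.tendsto_sum_nat
  have hm' : AEStronglyMeasurable (fun x => ∑' i, ‖F i x‖) μ := by
    refine aestronglyMeasurable_of_tendsto_ae Filter.atTop
      (f := fun N x => ∑ i ∈ Finset.range N, ‖F i x‖)
      (fun N => Finset.aestronglyMeasurable_fun_sum _ fun i _ => (hF i).1.norm) ?_
    filter_upwards [hae] with x hx
    exact hx.hasSum.tendsto_sum_nat
  have h2 : Integrable (fun x => ∑' i, ‖F i x‖) μ := by
    refine ⟨hm', ?_⟩
    refine lt_of_le_of_lt (lintegral_mono_ae ?_) hlt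
    filter_upwards [hae] with x hx
    rw [← ofReal_norm, Real.norm_of_nonneg (tsum_nonneg fun _ => norm_nonneg _),
      ENNReal.ofReal_tsum_of_nonneg (fun _ => norm_nonneg _) hx]
    simp
  refine ⟨h2.mono' hm ?_, hae, h2⟩
  filter_upwards [hae] with x hx using norm_tsum_le_tsum_norm hx

/-! ### Weighted Wiener algebras: products, exponentials, multipliers -/

variable {n : ℕ}

/-- The submultiplicative weight `(1 + |ξ|)^s`. -/
noncomputable def wt {n : ℕ} (s : ℕ) (ξ : Rn n) : ℝ := (1 + ‖ξ‖) ^ s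

theorem one_le_wt (s : ℕ) (ξ : Rn n) : 1 ≤ wt s ξ :=
  one_le_pow₀ (by linarith [norm_nonneg ξ])

theorem wt_pos (s : ℕ) (ξ : Rn n) : 0 < wt s ξ := lt_of_lt_of_le one_pos (one_le_wt s ξ)

theorem continuous_wt (s : ℕ) : Continuous (wt s : Rn n → ℝ) := by
  unfold wt; fun_prop

theorem wt_mono {s t : ℕ} (h : s ≤ t) (ξ : Rn n) : wt s ξ ≤ wt t ξ :=
  pow_le_pow_right₀ (by linarith [norm_nonneg ξ]) h

/-- Submultiplicativity of the weight is what makes the weighted `L¹` space closed under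
convolution, and so its inverse Fourier image an algebra. -/
theorem wt_sub_le (s : ℕ) (ξ η : Rn n) : wt s ξ ≤ wt s η * wt s (ξ - η) := by
  unfold wt
  rw [← mul_pow]
  refine pow_le_pow_left₀ (by positivity) ?_ s
  have : ‖ξ‖ ≤ ‖η‖ + ‖ξ - η‖ := by simpa using norm_add_le η (ξ - η)
  nlinarith [norm_nonneg η, norm_nonneg (ξ - η)]

/-- `g` is the inverse Fourier transform of a function whose `L¹` norm with weight `(1 + |ξ|)^s`
is at most `N`. -/
def BndA (s : ℕ) (N : ℝ) (g : Rn n → ℂ) : Prop :=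
  ∃ a : Rn n → ℂ, Integrable a ∧ Integrable (fun ξ => wt s ξ * ‖a ξ‖) ∧
    ∫ ξ, wt s ξ * ‖a ξ‖ ≤ N ∧ ∀ x, g x = 𝓕⁻ a x

/-- The weighted Wiener algebra of order `s`. -/
def MemA (s : ℕ) (g : Rn n → ℂ) : Prop := ∃ N, BndA s N g

theorem MemA.of_fourierInv {s : ℕ} {a : Rn n → ℂ} (ha : AEStronglyMeasurable a)
    (h : Integrable (fun ξ => wt s ξ * ‖a ξ‖)) : MemA s (𝓕⁻ a) := by
  refine ⟨_, a, h.mono' ha ?_, h, le_rfl, fun _ => rfl⟩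
  refine Filter.Eventually.of_forall fun ξ => ?_
  nlinarith [one_le_wt s ξ, norm_nonneg (a ξ)]

theorem fourierInv_integrand_integrable {a : Rn n → ℂ} (ha : Integrable a) (x : Rn n) :
    Integrable fun ξ => Real.fourierChar (inner ℝ ξ x) • a ξ := by
  have := (Real.fourierIntegral_convergent_iff (f := a) (-x)).2 ha
  simpa using this

theorem fourierInv_add' {a b : Rn n → ℂ} (ha : Integrable a) (hb : Integrable b) (x : Rn n) :
    𝓕⁻ (fun ξ => a ξ + b ξ) x = 𝓕⁻ a x + 𝓕⁻ b x := by
  simp only [Real.fourierInv_eq, smul_add]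
  exact integral_add (fourierInv_integrand_integrable ha x) (fourierInv_integrand_integrable hb x)

theorem fourierInv_const_mul (c : ℂ) (a : Rn n → ℂ) (x : Rn n) :
    𝓕⁻ (fun ξ => c * a ξ) x = c * 𝓕⁻ a x := by
  simp only [Real.fourierInv_eq, ← integral_const_mul]
  refine integral_congr_ae (Filter.Eventually.of_forall fun ξ => ?_)
  simp only [Circle.smul_def, smul_eq_mul]
  ring

theorem MemA.add {s : ℕ} {g h : Rn n → ℂ} (hg : MemA s g) (hh : MemA s h) :
    MemA s (fun x => g x + h x) := by
  obtain ⟨_, a, ha, ha', -, hga⟩ := hg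
  obtain ⟨_, b, hb, hb', -, hhb⟩ := hh
  have : MemA s (𝓕⁻ fun ξ => a ξ + b ξ) := by
    refine .of_fourierInv (ha.add hb).1 ((ha'.add hb').mono' ?_ ?_)
    · exact (continuous_wt s).aestronglyMeasurable.mul (ha.add hb).1.norm
    · refine Filter.Eventually.of_forall fun ξ => ?_
      rw [Real.norm_of_nonneg (mul_nonneg (wt_pos s ξ).le (norm_nonneg _))]
      simp only [Pi.add_apply, ← mul_add]
      exact mul_le_mul_of_nonneg_left (norm_add_le _ _) (wt_pos s ξ).le
  convert this using 1
  ext x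
  rw [hga, hhb, fourierInv_add' ha hb]

theorem BndA.const_mul {s : ℕ} {N : ℝ} {g : Rn n → ℂ} (hg : BndA s N g) (c : ℂ) :
    BndA s (‖c‖ * N) (fun x => c * g x) := by
  obtain ⟨a, ha, ha', hN, hga⟩ := hg
  have he : ∀ ξ, wt s ξ * ‖c * a ξ‖ = ‖c‖ * (wt s ξ * ‖a ξ‖) := fun ξ => by
    rw [norm_mul]; ring
  refine ⟨fun ξ => c * a ξ, ha.const_mul c, ?_, ?_, fun x => ?_⟩
  · simp only [he]; exact ha'.const_mul _
  · simp only [he, integral_const_mul]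
    exact mul_le_mul_of_nonneg_left hN (norm_nonneg c)
  · rw [fourierInv_const_mul, ← hga]

theorem MemA.const_mul {s : ℕ} {g : Rn n → ℂ} (hg : MemA s g) (c : ℂ) :
    MemA s (fun x => c * g x) := hg.imp' _ fun _ h => h.const_mul c

theorem MemA.mono {s t : ℕ} (h : s ≤ t) {g : Rn n → ℂ} (hg : MemA t g) : MemA s g := by
  obtain ⟨_, a, ha, ha', -, hga⟩ := hg
  have : MemA s (𝓕⁻ a) := by
    refine .of_fourierInv ha.1 (ha'.mono' ?_ ?_)
    · exact (continuous_wt s).aestronglyMeasurable.mul ha.1.norm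
    · refine Filter.Eventually.of_forall fun ξ => ?_
      rw [Real.norm_of_nonneg (mul_nonneg (wt_pos s ξ).le (norm_nonneg _))]
      exact mul_le_mul_of_nonneg_right (wt_mono h ξ) (norm_nonneg _)
  rwa [show g = 𝓕⁻ a from funext hga]

theorem fourierInv_mul_convolution {a b : Rn n → ℂ} (ha : Integrable a) (hb : Integrable b)
    (x : Rn n) : 𝓕⁻ (convolution a b (ContinuousLinearMap.mul ℂ ℂ) volume) x
      = 𝓕⁻ a x * 𝓕⁻ b x := by
  simp only [Real.fourierInv_eq_fourier_neg]
  exact Real.fourier_mul_convolution_eq ha hb (-x)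

/-- A product is the inverse transform of a convolution, and the weight distributes over it by
`wt_sub_le`. The constant is exactly `M * N`, so that powers have geometric bounds and the
exponential series converges. -/
theorem BndA.mul {s : ℕ} {M N : ℝ} {g h : Rn n → ℂ} (hg : BndA s M g) (hh : BndA s N h) :
    BndA s (M * N) (fun x => g x * h x) := by
  obtain ⟨a, ha, ha', hM, hga⟩ := hg
  obtain ⟨b, hb, hb', hN, hhb⟩ := hh
  set L := ContinuousLinearMap.mul ℝ ℝ
  set c := convolution a b (ContinuousLinearMap.mul ℂ ℂ) volume with hc
  have hci : Integrable c := ha.integrable_convolution _ hb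
  set A := fun ξ => wt s ξ * ‖a ξ‖
  set B := fun ξ => wt s ξ * ‖b ξ‖
  have hcv : Integrable (convolution A B L volume) := ha'.integrable_convolution _ hb'
  have hle : ∀ᵐ ξ, wt s ξ * ‖c ξ‖ ≤ convolution A B L volume ξ := by
    filter_upwards [(ha'.convolution_integrand L hb').prod_right_ae] with ξ hξ
    rw [hc, convolution_def, convolution_def]
    refine (mul_le_mul_of_nonneg_left (norm_integral_le_integral_norm _) (wt_pos s ξ).le).trans ?_
    rw [← integral_const_mul]
    refine integral_mono_of_nonneg (Filter.Eventually.of_forall fun η =>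
      mul_nonneg (wt_pos s ξ).le (norm_nonneg _)) hξ (Filter.Eventually.of_forall fun η => ?_)
    simp only [ContinuousLinearMap.mul_apply', norm_mul, L, A, B]
    have := mul_le_mul_of_nonneg_right (wt_sub_le s ξ η)
      (mul_nonneg (norm_nonneg (a η)) (norm_nonneg (b (ξ - η))))
    linarith
  refine ⟨c, hci, hcv.mono' ((continuous_wt s).aestronglyMeasurable.mul hci.1.norm) ?_, ?_,
    fun x => ?_⟩
  · filter_upwards [hle] with ξ hξ
    rwa [Real.norm_of_nonneg (mul_nonneg (wt_pos s ξ).le (norm_nonneg _))]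
  · have h1 : ∫ ξ, wt s ξ * ‖c ξ‖ ≤ ∫ ξ, convolution A B L volume ξ :=
      integral_mono_of_nonneg (Filter.Eventually.of_forall fun η =>
        mul_nonneg (wt_pos s _).le (norm_nonneg _)) hcv hle
    rw [integral_convolution L ha' hb'] at h1
    refine h1.trans ?_
    have hA : 0 ≤ ∫ ξ, A ξ := integral_nonneg fun η => mul_nonneg (wt_pos s _).le (norm_nonneg _)
    have hB : 0 ≤ ∫ ξ, B ξ := integral_nonneg fun η => mul_nonneg (wt_pos s _).le (norm_nonneg _)
    exact mul_le_mul hM hN hB (hA.trans hM)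
  · rw [hc, fourierInv_mul_convolution ha hb, ← hga, ← hhb]

theorem MemA.mul {s : ℕ} {g h : Rn n → ℂ} (hg : MemA s g) (hh : MemA s h) :
    MemA s (fun x => g x * h x) := by
  obtain ⟨M, hM⟩ := hg
  obtain ⟨N, hN⟩ := hh
  exact ⟨_, hM.mul hN⟩

theorem BndA.pow_succ {s : ℕ} {N : ℝ} {g : Rn n → ℂ} (hg : BndA s N g) (k : ℕ) :
    BndA s (N ^ (k + 1)) (fun x => g x ^ (k + 1)) := by
  induction k with
  | zero => simpa using hg
  | succ k ih => simpa only [_root_.pow_succ] using ih.mul hg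

theorem BndA.tsum {s : ℕ} {N : ℕ → ℝ} {g : ℕ → Rn n → ℂ} (hg : ∀ k, BndA s (N k) (g k))
    (hN : Summable N) : MemA s (fun x => ∑' k, g k x) := by
  choose a ha ha' haN hga using hg
  have hs : Summable fun k => ∫ ξ, ‖wt s ξ * ‖a k ξ‖‖ := by
    refine Summable.of_nonneg_of_le (fun k => integral_nonneg fun ξ => norm_nonneg _)
      (fun k => ?_) hN
    refine le_trans (le_of_eq ?_) (haN k)
    refine integral_congr_ae (Filter.Eventually.of_forall fun ξ => ?_)
    exact Real.norm_of_nonneg (mul_nonneg (wt_pos s ξ).le (norm_nonneg _))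
  have hs0 : Summable fun k => ∫ ξ, ‖a k ξ‖ := by
    refine Summable.of_nonneg_of_le (fun k => integral_nonneg fun ξ => norm_nonneg _)
      (fun k => ?_) hN
    refine le_trans (integral_mono (ha k).norm (ha' k) fun ξ => ?_) (haN k)
    have := one_le_wt s ξ
    simp only
    nlinarith [norm_nonneg (a k ξ)]
  obtain ⟨h1, h2, -⟩ := integrable_tsum_of_summable_integral_norm ha hs0
  obtain ⟨h3, -, -⟩ := integrable_tsum_of_summable_integral_norm ha' hs
  have : MemA s (𝓕⁻ fun ξ => ∑' k, a k ξ) := by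
    refine .of_fourierInv h1.1 (h3.mono' ((continuous_wt s).aestronglyMeasurable.mul h1.1.norm) ?_)
    filter_upwards [h2] with ξ hξ
    rw [Real.norm_of_nonneg (mul_nonneg (wt_pos s ξ).le (norm_nonneg _)), tsum_mul_left]
    exact mul_le_mul_of_nonneg_left (norm_tsum_le_tsum_norm hξ) (wt_pos s ξ).le
  convert this using 1
  ext x
  simp only [hga, Real.fourierInv_eq]
  rw [integral_tsum_of_summable_integral_norm
    (fun k => fourierInv_integrand_integrable (ha k) x) (by simpa using hs0)]
  refine integral_congr_ae ?_
  filter_upwards [h2] with ξ hξ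
  simp only [Circle.smul_def, smul_eq_mul]
  rw [tsum_mul_left]

/-- The exponential series converges in the algebra, its terms being bounded by `N^(k+1)/(k+1)!`.
The constant term is removed because inverse transforms of `L¹` functions vanish at infinity, so for
`n ≥ 1` the algebra has no unit. -/
theorem MemA.exp_sub_one {s : ℕ} {g : Rn n → ℂ} (hg : MemA s g) :
    MemA s (fun x => Complex.exp (g x) - 1) := by
  obtain ⟨N, hN⟩ := hg
  have hN0 : 0 ≤ N := by
    obtain ⟨a, -, -, h, -⟩ := hN
    exact le_trans (integral_nonneg fun ξ => mul_nonneg (wt_pos s ξ).le (norm_nonneg _)) h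
  have := BndA.tsum (fun k => (hN.pow_succ k).const_mul (((k + 1).factorial : ℂ)⁻¹)) (by
    have := (summable_nat_add_iff 1).2 (Real.summable_pow_div_factorial N)
    refine this.congr fun k => ?_
    simp [div_eq_inv_mul])
  convert this using 1
  ext x
  have h1 := NormedSpace.expSeries_div_hasSum_exp (𝔸 := ℂ) (g x)
  rw [← Complex.exp_eq_exp_ℂ] at h1
  have h2 := (hasSum_nat_add_iff' 1).2 h1
  simp only [Finset.range_one, Finset.sum_singleton, pow_zero, Nat.factorial_zero, Nat.cast_one,
    div_one] at h2
  rw [← h2.tsum_eq]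
  simp [div_eq_inv_mul]

theorem MemA.of_schwartz (s : ℕ) (φ : 𝓢(Rn n, ℂ)) : MemA s (φ : Rn n → ℂ) := by
  have h : (φ : Rn n → ℂ) = 𝓕⁻ ((𝓕 φ : 𝓢(Rn n, ℂ)) : Rn n → ℂ) := by
    rw [← SchwartzMap.fourierInv_coe]; simp
  rw [h]
  refine .of_fourierInv (𝓕 φ).continuous.aestronglyMeasurable ?_
  have h0 : ∀ k ≤ s, Integrable fun ξ => (‖ξ‖ ^ k * ‖(𝓕 φ) ξ‖) := fun k _ =>
    (𝓕 φ).integrable_pow_mul volume k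
  have : (fun ξ : Rn n => wt s ξ * ‖(𝓕 φ) ξ‖)
      = fun ξ => ∑ k ∈ Finset.range (s + 1), (s.choose k : ℝ) * (‖ξ‖ ^ k * ‖(𝓕 φ) ξ‖) := by
    ext ξ
    rw [wt, add_comm 1, add_pow, Finset.sum_mul]
    refine Finset.sum_congr rfl fun k _ => ?_
    simp; ring
  rw [this]
  exact integrable_finsetSum _ fun k hk => (h0 k (by grind)).const_mul _

theorem MemA.of_contDiff_hasCompactSupport (s : ℕ) {g : Rn n → ℂ} (hg : ContDiff ℝ ∞ g)
    (hc : HasCompactSupport g) : MemA s g :=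
  MemA.of_schwartz s (hc.toSchwartzMap hg)

/-- The weight controls the moments of order up to `s`, which allow `s` differentiations under the
Fourier integral. -/
theorem MemA.contDiff {s : ℕ} {g : Rn n → ℂ} (hg : MemA s g) : ContDiff ℝ s g := by
  obtain ⟨_, a, ha, ha', -, hga⟩ := hg
  rw [show g = 𝓕⁻ a from funext hga,
    show 𝓕⁻ a = (𝓕 a) ∘ Neg.neg from funext fun x => Real.fourierInv_eq_fourier_neg a x]
  refine ContDiff.comp (Real.contDiff_fourier (N := s) fun k hk => ?_) contDiff_neg
  refine ha'.mono' ((continuous_norm.pow k).aestronglyMeasurable.mul ha.1.norm)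
    (Filter.Eventually.of_forall fun ξ => ?_)
  rw [Real.norm_of_nonneg (by positivity)]
  refine mul_le_mul_of_nonneg_right ?_ (norm_nonneg _)
  refine le_trans ?_ (wt_mono (by exact_mod_cast hk) ξ)
  exact pow_le_pow_left₀ (norm_nonneg _) (by linarith [norm_nonneg ξ]) k

theorem MemA.continuous {s : ℕ} {g : Rn n → ℂ} (hg : MemA s g) : Continuous g :=
  hg.contDiff.continuous

/-- Convolution with an integrable kernel acts on inverse Fourier transforms as a multiplier. -/
theorem integral_kernel_mul_fourierInv {K a : Rn n → ℂ} (hK : Integrable K) (ha : Integrable a)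
    (x : Rn n) : ∫ y, K (x - y) * 𝓕⁻ a y = 𝓕⁻ (fun ξ => 𝓕 K ξ * a ξ) x := by
  have h1 : ∫ y, K (x - y) * 𝓕⁻ a y = ∫ y, K y * 𝓕⁻ a (x - y) := by
    rw [← integral_sub_left_eq_self _ volume x]; simp
  rw [h1]
  have h2 : ∀ y, K y * 𝓕⁻ a (x - y)
      = ∫ ξ, Real.fourierChar (-inner ℝ y ξ) • (K y * (Real.fourierChar (inner ℝ ξ x) • a ξ)) := by
    intro y
    rw [Real.fourierInv_eq, ← integral_const_mul]
    refine integral_congr_ae (Filter.Eventually.of_forall fun ξ => ?_)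
    have h : inner ℝ ξ (x - y) = -inner ℝ y ξ + inner ℝ ξ x := by
      rw [inner_sub_right, real_inner_comm y ξ]; ring
    simp only [h, AddChar.map_add_eq_mul, Circle.smul_def, smul_eq_mul, Circle.coe_mul]
    ring
  simp only [h2]
  rw [integral_integral_swap, Real.fourierInv_eq]
  · refine integral_congr_ae (Filter.Eventually.of_forall fun ξ => ?_)
    simp only [Real.fourier_eq, Circle.smul_def, smul_eq_mul]
    rw [← integral_mul_const, ← integral_const_mul]
    refine integral_congr_ae (Filter.Eventually.of_forall fun y => ?_)
    simp only
    ring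
  · have h := hK.mul_prod (fourierInv_integrand_integrable ha x)
    refine h.mono ?_ ?_
    · exact (Real.continuous_fourierChar.comp (by fun_prop)).aestronglyMeasurable.smul h.1
    · exact Filter.Eventually.of_forall fun p => by
        simp [Function.uncurry]

/-- Decay of order `m` of the multiplier `𝓕 K` is traded for `m` further powers of the weight. -/
theorem MemA.conv {s m : ℕ} {C : ℝ} {K g : Rn n → ℂ} (hK : Integrable K)
    (hm : ∀ ξ, ‖𝓕 K ξ‖ * wt m ξ ≤ C) (hg : MemA s g) :
    MemA (s + m) (fun x => ∫ y, K (x - y) * g y) := by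
  obtain ⟨_, a, ha, ha', -, hga⟩ := hg
  have : (fun x => ∫ y, K (x - y) * g y) = 𝓕⁻ fun ξ => 𝓕 K ξ * a ξ := by
    ext x
    simp only [hga]
    exact integral_kernel_mul_fourierInv hK ha x
  rw [this]
  have hmeas : AEStronglyMeasurable (fun ξ => 𝓕 K ξ * a ξ) := by
    refine AEStronglyMeasurable.mul (Continuous.aestronglyMeasurable ?_) ha.1
    exact VectorFourier.fourierIntegral_continuous Real.continuous_fourierChar
      (by exact continuous_inner) hK
  refine .of_fourierInv hmeas ((ha'.const_mul C).mono'
    ((continuous_wt _).aestronglyMeasurable.mul hmeas.norm) (Filter.Eventually.of_forall fun ξ => ?_))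
  rw [Real.norm_of_nonneg (mul_nonneg (wt_pos _ ξ).le (norm_nonneg _)), norm_mul]
  have h1 : wt (s + m) ξ = wt s ξ * wt m ξ := pow_add _ _ _
  rw [h1]
  calc wt s ξ * wt m ξ * (‖𝓕 K ξ‖ * ‖a ξ‖) = (‖𝓕 K ξ‖ * wt m ξ) * (wt s ξ * ‖a ξ‖) := by ring
    _ ≤ C * (wt s ξ * ‖a ξ‖) :=
      mul_le_mul_of_nonneg_right (hm ξ) (mul_nonneg (wt_pos s ξ).le (norm_nonneg _))

/-! ### Smoothness of convolutions, and gluing over balls -/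

/-- Differentiation under the integral, by induction on `m`. The derivative of `ρ` takes values in
another normed space, so `F` is quantified inside the induction. The domination hypothesis covers
all orders `k`, hence passes to `fderiv ℝ ρ` by a shift. -/
theorem contDiff_nat_integral_smul_sub {W : Rn n → ℝ} (hW : AEStronglyMeasurable W) (m : ℕ) :
    ∀ {F : Type} [NormedAddCommGroup F] [NormedSpace ℝ F] {ρ : Rn n → F}, ContDiff ℝ ∞ ρ →
      (∀ (k : ℕ) (R : ℝ), ∃ b : Rn n → ℝ, Integrable b ∧
        ∀ x ∈ Metric.ball (0 : Rn n) R, ∀ y, |W y| * ‖iteratedFDeriv ℝ k ρ (x - y)‖ ≤ b y) →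
      ContDiff ℝ m (fun x => ∫ y, W y • ρ (x - y)) := by
  induction m with
  | zero =>
    intro F _ _ ρ hρ hb
    rw [Nat.cast_zero, contDiff_zero, continuous_iff_continuousAt]
    intro x₀
    obtain ⟨b, hbi, hb⟩ := hb 0 (‖x₀‖ + 1)
    have hmem : ∀ᶠ x in nhds x₀, x ∈ Metric.ball (0 : Rn n) (‖x₀‖ + 1) :=
      Metric.isOpen_ball.mem_nhds (by simp)
    refine continuousAt_of_dominated (bound := b) ?_ ?_ hbi ?_
    · exact Filter.Eventually.of_forall fun x =>
        hW.smul (hρ.continuous.comp (by fun_prop)).aestronglyMeasurable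
    · filter_upwards [hmem] with x hx
      refine Filter.Eventually.of_forall fun y => ?_
      have := hb x hx y
      rwa [norm_iteratedFDeriv_zero, ← Real.norm_eq_abs, ← norm_smul] at this
    · refine Filter.Eventually.of_forall fun y => ?_
      exact ((hρ.continuous.comp (by fun_prop)).const_smul (W y)).continuousAt
  | succ m ih =>
    intro F _ _ ρ hρ hb
    have hρ' : ContDiff ℝ ∞ (fderiv ℝ ρ) := hρ.fderiv_right (by simp)
    have hd : ∀ x₀, HasFDerivAt (fun x => ∫ y, W y • ρ (x - y))
        (∫ y, W y • fderiv ℝ ρ (x₀ - y)) x₀ := by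
      intro x₀
      obtain ⟨b0, hb0i, hb0⟩ := hb 0 (‖x₀‖ + 1)
      obtain ⟨b, hbi, hb⟩ := hb 1 (‖x₀‖ + 1)
      refine hasFDerivAt_integral_of_dominated_of_fderiv_le (𝕜 := ℝ)
        (F := fun x y => W y • ρ (x - y)) (F' := fun x y => W y • fderiv ℝ ρ (x - y))
        (bound := b)
        (x₀ := x₀)
        (s := Metric.ball (0 : Rn n) (‖x₀‖ + 1)) (Metric.isOpen_ball.mem_nhds (by simp))
        ?_ ?_ ?_ ?_ hbi ?_
      · exact Filter.Eventually.of_forall fun x =>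
          hW.smul (hρ.continuous.comp (by fun_prop)).aestronglyMeasurable
      · refine hb0i.mono' (hW.smul (hρ.continuous.comp (by fun_prop)).aestronglyMeasurable)
          (Filter.Eventually.of_forall fun y => ?_)
        have := hb0 x₀ (by simp) y
        rwa [norm_iteratedFDeriv_zero, ← Real.norm_eq_abs, ← norm_smul] at this
      · exact hW.smul (hρ'.continuous.comp (by fun_prop)).aestronglyMeasurable
      · refine Filter.Eventually.of_forall fun y x hx => ?_
        have := hb x hx y
        rwa [← Real.norm_eq_abs, ← norm_fderiv_iteratedFDeriv,
          show ‖fderiv ℝ (iteratedFDeriv ℝ 0 ρ) (x - y)‖ = ‖fderiv ℝ ρ (x - y)‖ by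
            rw [norm_fderiv_iteratedFDeriv, norm_iteratedFDeriv_one], ← norm_smul] at this
      · refine Filter.Eventually.of_forall fun y x _ => ?_
        have h1 : HasFDerivAt ρ (fderiv ℝ ρ (x - y)) (x - y) :=
          (hρ.differentiable (by simp) _).hasFDerivAt
        have h2 : HasFDerivAt (fun x => ρ (x - y)) (fderiv ℝ ρ (x - y)) x := by
          have := h1.comp x ((hasFDerivAt_id x).sub_const y)
          rwa [ContinuousLinearMap.comp_id] at this
        exact h2.const_smul (W y)
    have hih := ih hρ' (fun k R => by
      obtain ⟨b, hbi, hb⟩ := hb (k + 1) R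
      refine ⟨b, hbi, fun x hx y => ?_⟩
      rw [norm_iteratedFDeriv_fderiv]
      exact hb x hx y)
    rw [Nat.cast_add, Nat.cast_one, contDiff_succ_iff_fderiv]
    refine ⟨fun x => (hd x).differentiableAt, by simp, ?_⟩
    rwa [show fderiv ℝ (fun x => ∫ y, W y • ρ (x - y)) = fun x => ∫ y, W y • fderiv ℝ ρ (x - y)
      from funext fun x => (hd x).fderiv]

theorem contDiff_integral_mul_sub {W : Rn n → ℝ} (hW : AEStronglyMeasurable W) {ρ : Rn n → ℂ}
    (hρ : ContDiff ℝ ∞ ρ)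
    (hb : ∀ (k : ℕ) (R : ℝ), ∃ b : Rn n → ℝ, Integrable b ∧
      ∀ x ∈ Metric.ball (0 : Rn n) R, ∀ y, |W y| * ‖iteratedFDeriv ℝ k ρ (x - y)‖ ≤ b y) :
    ContDiff ℝ ∞ (fun x => ∫ y, ρ (x - y) * (W y : ℂ)) := by
  have h : (fun x => ∫ y, ρ (x - y) * (W y : ℂ)) = fun x => ∫ y, W y • ρ (x - y) := by
    ext x
    refine integral_congr_ae (Filter.Eventually.of_forall fun y => ?_)
    simp [mul_comm]
  rw [h, contDiff_infty]
  exact fun m => contDiff_nat_integral_smul_sub hW m hρ hb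

/-- Convolution of an integrable function with a smooth one whose derivatives are bounded. -/
theorem contDiff_integral_mul_sub_of_bounded {W : Rn n → ℝ} (hW : Integrable W) {ρ : Rn n → ℂ}
    (hρ : ContDiff ℝ ∞ ρ) (hb : ∀ k : ℕ, ∃ C, ∀ x, ‖iteratedFDeriv ℝ k ρ x‖ ≤ C) :
    ContDiff ℝ ∞ (fun x => ∫ y, ρ (x - y) * (W y : ℂ)) := by
  refine contDiff_integral_mul_sub hW.1 hρ fun k R => ?_
  obtain ⟨C, hC⟩ := hb k
  exact ⟨fun y => |W y| * C, hW.abs.mul_const C, fun x _ y =>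
    mul_le_mul_of_nonneg_left (hC _) (abs_nonneg _)⟩

theorem one_add_norm_le_mul (x y : Rn n) : 1 + ‖y‖ ≤ (1 + ‖x‖) * (1 + ‖x - y‖) := by
  have : ‖y‖ ≤ ‖x‖ + ‖x - y‖ := by simpa using norm_sub_le x (x - y)
  nlinarith [norm_nonneg x, norm_nonneg (x - y)]

theorem one_add_rpow_le_one_add_pow {p : ℝ} (hp : 0 ≤ p) {N : ℕ} (hN : p ≤ N) {t : ℝ}
    (ht : 0 ≤ t) : 1 + t ^ p ≤ 2 * (1 + t) ^ N := by
  have h1 : (1 : ℝ) ≤ (1 + t) ^ N := one_le_pow₀ (by linarith)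
  have h2 : t ^ p ≤ (1 + t) ^ N := calc
    t ^ p ≤ (1 + t) ^ p := Real.rpow_le_rpow ht (by linarith) hp
    _ ≤ (1 + t) ^ (N : ℝ) := Real.rpow_le_rpow_of_exponent_le (by linarith) hN
    _ = (1 + t) ^ N := Real.rpow_natCast _ _
  linarith

/-- Peetre's inequality `one_add_norm_le_mul` converts decay in `x - y` into decay in `y`, at the
price of polynomial growth in `x`, which is harmless for `x` in a bounded set. -/
theorem schwartz_decay_weight (φ : 𝓢(Rn n, ℂ)) (k : ℕ) {p : ℝ} (hp : 0 ≤ p) :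
    ∃ C, 0 ≤ C ∧ ∃ N : ℕ, ∀ x y : Rn n,
      ‖iteratedFDeriv ℝ k φ (x - y)‖ ≤ C * (1 + ‖x‖) ^ N * (1 / (1 + ‖y‖ ^ p)) := by
  obtain ⟨N, hN⟩ := exists_nat_ge p
  set C := 2 ^ N * ((Finset.Iic (N, k)).sup fun m => SchwartzMap.seminorm ℝ m.1 m.2) φ
  have hC : ∀ z : Rn n, (1 + ‖z‖) ^ N * ‖iteratedFDeriv ℝ k φ z‖ ≤ C := fun z =>
    SchwartzMap.one_add_le_sup_seminorm_apply (𝕜 := ℝ) (m := (N, k)) le_rfl le_rfl φ z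
  have hC0 : 0 ≤ C := le_trans (by positivity) (hC 0)
  refine ⟨2 * C, by positivity, N, fun x y => ?_⟩
  have hpos : 0 < 1 + ‖y‖ ^ p := by have := Real.rpow_nonneg (norm_nonneg y) p; linarith
  rw [mul_one_div, le_div_iff₀ hpos]
  have h1 := one_add_rpow_le_one_add_pow hp hN (norm_nonneg y)
  have h2 : (1 + ‖y‖) ^ N ≤ (1 + ‖x‖) ^ N * (1 + ‖x - y‖) ^ N := by
    rw [← mul_pow]
    exact pow_le_pow_left₀ (by positivity) (one_add_norm_le_mul x y) N
  calc ‖iteratedFDeriv ℝ k φ (x - y)‖ * (1 + ‖y‖ ^ p)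
      ≤ ‖iteratedFDeriv ℝ k φ (x - y)‖ * (2 * ((1 + ‖x‖) ^ N * (1 + ‖x - y‖) ^ N)) :=
        mul_le_mul_of_nonneg_left (by linarith) (norm_nonneg _)
    _ = 2 * (1 + ‖x‖) ^ N * ((1 + ‖x - y‖) ^ N * ‖iteratedFDeriv ℝ k φ (x - y)‖) := by ring
    _ ≤ 2 * (1 + ‖x‖) ^ N * C := mul_le_mul_of_nonneg_left (hC _) (by positivity)
    _ = 2 * C * (1 + ‖x‖) ^ N := by ring

/-- Convolution of a function of polynomial growth with a Schwartz function is smooth. -/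
theorem contDiff_integral_schwartz_mul_sub {W : Rn n → ℝ} {p : ℝ} (hp : 0 ≤ p)
    (hWm : AEStronglyMeasurable W)
    (hW : Integrable fun x => |W x| / (1 + ‖x‖ ^ p)) (φ : 𝓢(Rn n, ℂ)) :
    ContDiff ℝ ∞ (fun x => ∫ y, φ (x - y) * (W y : ℂ)) := by
  refine contDiff_integral_mul_sub hWm (φ.smooth ⊤) fun k R => ?_
  obtain ⟨C, hC, N, h⟩ := schwartz_decay_weight φ k hp
  refine ⟨fun y => C * (1 + |R|) ^ N * (|W y| / (1 + ‖y‖ ^ p)), hW.const_mul _, fun x hx y => ?_⟩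
  have hx' : ‖x‖ ≤ |R| := (mem_ball_zero_iff.1 hx).le.trans (le_abs_self R)
  have hpos : 0 < 1 + ‖y‖ ^ p := by have := Real.rpow_nonneg (norm_nonneg y) p; linarith
  calc |W y| * ‖iteratedFDeriv ℝ k φ (x - y)‖
      ≤ |W y| * (C * (1 + ‖x‖) ^ N * (1 / (1 + ‖y‖ ^ p))) :=
        mul_le_mul_of_nonneg_left (h x y) (abs_nonneg _)
    _ ≤ |W y| * (C * (1 + |R|) ^ N * (1 / (1 + ‖y‖ ^ p))) := by gcongr
    _ = _ := by ring

/-- A function that agrees almost everywhere on every ball with a smooth function agrees almost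
everywhere with a smooth function. -/
theorem exists_contDiff_of_forall_ball {F : Type*} [NormedAddCommGroup F] [NormedSpace ℝ F]
    {h : Rn n → F} (H : ∀ R : ℕ, ∃ v : Rn n → F, ContDiff ℝ ∞ v ∧
      ∀ᵐ x, x ∈ Metric.ball (0 : Rn n) R → h x = v x) :
    ∃ v : Rn n → F, ContDiff ℝ ∞ v ∧ h =ᵐ[volume] v := by
  choose v hv hae using H
  have heq : ∀ i j : ℕ, i ≤ j → ∀ x ∈ Metric.ball (0 : Rn n) i, v i x = v j x := by
    intro i j hij
    have h1 : v i =ᵐ[volume.restrict (Metric.ball (0 : Rn n) i)] v j := by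
      rw [Filter.EventuallyEq, ae_restrict_iff' measurableSet_ball]
      filter_upwards [hae i, hae j] with x hi hj hx
      rw [← hi hx, ← hj (Metric.ball_subset_ball (by exact_mod_cast hij) hx)]
    exact Measure.eqOn_open_of_ae_eq h1 Metric.isOpen_ball (hv i).continuous.continuousOn
      (hv j).continuous.continuousOn
  -- The `+ 1` puts `x` strictly inside the open ball whose representative is used at `x`.
  have hlt : ∀ x : Rn n, ‖x‖ < ((⌈‖x‖⌉₊ + 1 : ℕ) : ℝ) := fun x => by
    push_cast; linarith [Nat.le_ceil ‖x‖]
  have key : ∀ (j : ℕ), ∀ x ∈ Metric.ball (0 : Rn n) j, v (⌈‖x‖⌉₊ + 1) x = v j x := by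
    intro j x hx
    rcases le_total (⌈‖x‖⌉₊ + 1) j with h | h
    · exact heq _ _ h x (mem_ball_zero_iff.2 (hlt x))
    · exact (heq _ _ h x hx).symm
  refine ⟨fun x => v (⌈‖x‖⌉₊ + 1) x, ?_, ?_⟩
  · rw [contDiff_iff_contDiffAt]
    intro x
    refine ((hv (⌈‖x‖⌉₊ + 1)).contDiffAt).congr_of_eventuallyEq ?_
    filter_upwards [Metric.isOpen_ball.mem_nhds (mem_ball_zero_iff.2 (hlt x))] with y hy
    exact key _ y hy
  · filter_upwards [ae_all_iff.2 hae] with x hx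
    exact hx _ (mem_ball_zero_iff.2 (hlt x))

/-! ### Test functions, Fourier inversion and the `L²` theory -/

theorem exists_isTest_ball {r R : ℝ} (hr : 0 < r) (hR : r < R) :
    ∃ χ : Rn n → ℝ, IsTest χ ∧ (∀ x ∈ Metric.ball (0 : Rn n) r, χ x = 1) ∧
      (∀ x, x ∉ Metric.ball (0 : Rn n) R → χ x = 0) ∧ (∀ x, 0 ≤ χ x ∧ χ x ≤ 1) ∧
      ∀ x, χ (-x) = χ x := by
  let b : ContDiffBump (0 : Rn n) := ⟨r, R, hr, hR⟩
  refine ⟨b, ⟨b.contDiff, b.hasCompactSupport⟩, fun x hx =>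
    b.one_of_mem_closedBall (Metric.ball_subset_closedBall hx), fun x hx => ?_,
    fun x => ⟨b.nonneg, b.le_one⟩, fun x => b.neg x⟩
  have := b.support_eq
  by_contra h
  exact hx (this ▸ Function.mem_support.2 h)

theorem IsTest.exists_support_subset_ball {χ : Rn n → ℝ} (hχ : IsTest χ) :
    ∃ R : ℝ, 0 < R ∧ ∀ x, x ∉ Metric.ball (0 : Rn n) R → χ x = 0 := by
  obtain ⟨R, hR⟩ := hχ.2.isCompact.isBounded.subset_ball (0 : Rn n)
  refine ⟨max R 1, by positivity, fun x hx => ?_⟩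
  by_contra h
  exact hx (Metric.ball_subset_ball (le_max_left _ _) (hR (subset_tsupport _ h)))

theorem IsTest.ofReal_contDiff {χ : Rn n → ℝ} (hχ : IsTest χ) :
    ContDiff ℝ ∞ (fun x => (χ x : ℂ)) := Complex.ofRealCLM.contDiff.comp hχ.1

theorem IsTest.ofReal_hasCompactSupport {χ : Rn n → ℝ} (hχ : IsTest χ) :
    HasCompactSupport (fun x => (χ x : ℂ)) :=
  hχ.2.comp_left (g := fun r : ℝ => (r : ℂ)) Complex.ofReal_zero

theorem IsTest.memA {χ : Rn n → ℝ} (hχ : IsTest χ) (s : ℕ) : MemA s (fun x => (χ x : ℂ)) :=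
  .of_contDiff_hasCompactSupport s hχ.ofReal_contDiff hχ.ofReal_hasCompactSupport

/-- A real test function as a complex Schwartz function. -/
noncomputable def IsTest.toSchwartz {χ : Rn n → ℝ} (hχ : IsTest χ) : 𝓢(Rn n, ℂ) :=
  hχ.ofReal_hasCompactSupport.toSchwartzMap hχ.ofReal_contDiff

@[simp] theorem IsTest.toSchwartz_apply {χ : Rn n → ℝ} (hχ : IsTest χ) (x : Rn n) :
    hχ.toSchwartz x = (χ x : ℂ) := rfl

theorem continuous_fourier {a : Rn n → ℂ} (ha : Integrable a) : Continuous (𝓕 a) :=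
  VectorFourier.fourierIntegral_continuous Real.continuous_fourierChar
    (by exact continuous_inner) ha

theorem continuous_fourierInv {a : Rn n → ℂ} (ha : Integrable a) : Continuous (𝓕⁻ a) := by
  rw [show 𝓕⁻ a = (𝓕 a) ∘ Neg.neg from funext fun x => Real.fourierInv_eq_fourier_neg a x]
  exact (continuous_fourier ha).comp continuous_neg

theorem integral_fourier_mul_eq_flip {f g : Rn n → ℂ} (hf : Integrable f) (hg : Integrable g) :
    ∫ ξ, 𝓕 f ξ * g ξ = ∫ x, f x * 𝓕 g x := by
  have := VectorFourier.integral_fourierIntegral_smul_eq_flip (μ := volume) (ν := volume)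
    (L := innerₗ (Rn n)) Real.continuous_fourierChar (by exact continuous_inner) hf hg
  rw [flip_innerₗ] at this
  exact this

theorem integral_fourierInv_mul_eq_flip {f g : Rn n → ℂ} (hf : Integrable f) (hg : Integrable g) :
    ∫ ξ, 𝓕⁻ f ξ * g ξ = ∫ x, f x * 𝓕⁻ g x := by
  have h1 := integral_fourier_mul_eq_flip hf.comp_neg hg
  rw [← Real.fourierInv_eq_fourier_comp_neg] at h1
  rw [h1, ← integral_neg_eq_self]
  simp [Real.fourierInv_eq_fourier_neg]

/-- Fourier inversion almost everywhere. -/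
theorem fourierInv_fourier_ae_eq {f : Rn n → ℂ} (hf : Integrable f) (hf' : Integrable (𝓕 f)) :
    f =ᵐ[volume] 𝓕⁻ (𝓕 f) := by
  -- By duality both transforms are moved onto a test function, where inversion holds in the
  -- Schwartz space.
  refine ae_eq_of_integral_contDiff_smul_eq hf.locallyIntegrable
    (continuous_fourierInv hf').locallyIntegrable fun φ h1 h2 => ?_
  let ψ : 𝓢(Rn n, ℂ) := IsTest.toSchwartz (χ := φ) ⟨h1, h2⟩
  have hψ : ∀ x, ψ x = (φ x : ℂ) := fun _ => rfl
  have e1 : ∫ x, φ x • f x = ∫ x, f x * 𝓕 (𝓕⁻ ψ : 𝓢(Rn n, ℂ)) x := by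
    refine integral_congr_ae (Filter.Eventually.of_forall fun x => ?_)
    simp [hψ, mul_comm]
  have e2 : ∫ x, φ x • 𝓕⁻ (𝓕 f) x = ∫ x, 𝓕⁻ (𝓕 f) x * ψ x := by
    refine integral_congr_ae (Filter.Eventually.of_forall fun x => ?_)
    simp [hψ, mul_comm]
  rw [e1, e2, integral_fourierInv_mul_eq_flip hf' ψ.integrable, SchwartzMap.fourier_coe,
    ← integral_fourier_mul_eq_flip hf (𝓕⁻ ψ : 𝓢(Rn n, ℂ)).integrable, SchwartzMap.fourierInv_coe]

/-- The Fourier transform of a function in `L¹ ∩ L²` is in `L²`. -/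
theorem memLp_two_fourier {f : Rn n → ℂ} (hf : Integrable f) (hf2 : MemLp f 2) :
    MemLp (𝓕 f) 2 := by
  set F := hf2.toLp f
  -- The `L²` Fourier transform and the Fourier integral define the same tempered distribution,
  -- hence agree almost everywhere.
  have h := Lp.fourier_toTemperedDistribution_eq F
  have hae : 𝓕 f =ᵐ[volume] (𝓕 F : Lp ℂ 2 (volume : Measure (Rn n))) := by
    refine ae_eq_of_integral_contDiff_smul_eq (continuous_fourier hf).locallyIntegrable
      ((Lp.memLp (𝓕 F)).locallyIntegrable (by norm_num)) fun φ h1 h2 => ?_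
    let ψ : 𝓢(Rn n, ℂ) := IsTest.toSchwartz (χ := φ) ⟨h1, h2⟩
    have hψ : ∀ x, ψ x = (φ x : ℂ) := fun _ => rfl
    have e := congrArg (fun T : 𝓢'(Rn n, ℂ) => T ψ) h
    simp only [TemperedDistribution.fourier_apply, Lp.toTemperedDistribution_apply] at e
    have e1 : ∫ x, φ x • 𝓕 f x = ∫ x, 𝓕 f x * ψ x := by
      refine integral_congr_ae (Filter.Eventually.of_forall fun x => ?_)
      simp [hψ, mul_comm]
    have e2 : ∫ x, φ x • (𝓕 F : Lp ℂ 2 (volume : Measure (Rn n))) x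
        = ∫ x, ψ x • (𝓕 F : Lp ℂ 2 (volume : Measure (Rn n))) x := by
      refine integral_congr_ae (Filter.Eventually.of_forall fun x => ?_)
      simp [hψ]
    rw [e1, e2, ← e, integral_fourier_mul_eq_flip hf ψ.integrable]
    refine integral_congr_ae ?_
    filter_upwards [hf2.coeFn_toLp] with x hx
    rw [hx, smul_eq_mul, mul_comm, SchwartzMap.fourier_coe]
  exact (memLp_congr_ae hae).2 (Lp.memLp _)

/-! ### Local Wiener regularity -/

/-- `u` belongs locally to the weighted Wiener algebra of order `s`. -/
def LocA (s : ℕ) (u : Rn n → ℝ) : Prop :=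
  ∀ χ : Rn n → ℝ, IsTest χ → ∃ g : Rn n → ℂ, MemA s g ∧
    (fun x => (χ x : ℂ) * (u x : ℂ)) =ᵐ[volume] g

theorem LocA.mono {s t : ℕ} (h : s ≤ t) {u : Rn n → ℝ} (hu : LocA t u) : LocA s u :=
  fun χ hχ => (hu χ hχ).imp fun _ hg => ⟨hg.1.mono h, hg.2⟩

theorem isSmooth_of_forall_locA {u : Rn n → ℝ} (hu : ∀ s, LocA s u) : IsSmooth u := by
  refine exists_contDiff_of_forall_ball fun R => ?_
  obtain ⟨χ, hχ, h1, -⟩ := exists_isTest_ball (n := n) (r := R + 1) (R := R + 2)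
    (by positivity) (by linarith)
  choose g hg hae using fun s => hu s χ hχ
  -- The representatives of different orders are continuous and equal almost everywhere, so a single
  -- function has all orders of smoothness.
  have heq : ∀ s, g s = g 0 := fun s =>
    Measure.eq_of_ae_eq ((hae s).symm.trans (hae 0)) (hg s).continuous (hg 0).continuous
  refine ⟨fun x => (g 0 x).re, ?_, ?_⟩
  · refine Complex.reCLM.contDiff.comp (contDiff_infty.2 fun s => ?_)
    rw [← heq s]
    exact (hg s).contDiff
  · filter_upwards [hae 0] with x hx hxR
    rw [← hx, h1 x (Metric.ball_subset_ball (by linarith) hxR)]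
    simp

/-- Composition with the exponential function. -/
theorem LocA.exp {s : ℕ} {u : Rn n → ℝ} (hu : LocA s u) (C c : ℝ) :
    LocA s (fun x => C * Real.exp (c * u x)) := by
  intro χ hχ
  obtain ⟨R, hR, hsupp⟩ := hχ.exists_support_subset_ball
  -- As `θ = 1` on the ball carrying `χ`, `u` may be replaced there by `θ u`, which lies in the
  -- algebra. The missing constant `1` of the exponential returns multiplied by `χ`.
  obtain ⟨θ, hθ, h1, -⟩ := exists_isTest_ball (n := n) hR (lt_add_one R)
  obtain ⟨g, hg, hae⟩ := hu θ hθ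
  refine ⟨fun x => (C : ℂ) * ((χ x : ℂ) * (Complex.exp ((c : ℂ) * g x) - 1) + χ x),
    (((hχ.memA s).mul (hg.const_mul c).exp_sub_one).add (hχ.memA s)).const_mul C, ?_⟩
  filter_upwards [hae] with x hx
  by_cases hxR : x ∈ Metric.ball (0 : Rn n) R
  · rw [← hx, h1 x hxR]
    push_cast
    rw [one_mul]
    ring
  · simp [hsupp x hxR]

/-- Convolution of a function in `L¹ ∩ L²` with a kernel whose Fourier transform is in `L²`
agrees almost everywhere with the inverse Fourier transform of an integrable function. -/
theorem exists_memA_zero_conv {K f : Rn n → ℂ} (hK : Integrable K) (hK2 : MemLp (𝓕 K) 2)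
    (hf : Integrable f) (hf2 : MemLp f 2) :
    ∃ g, MemA 0 g ∧ (fun x => ∫ y, K (x - y) * f y) =ᵐ[volume] g := by
  have he : (fun x => ∫ y, K (x - y) * f y)
      = convolution f K (ContinuousLinearMap.mul ℂ ℂ) volume := by
    ext x
    simp [convolution_def, mul_comm]
  have hF : 𝓕 (fun x => ∫ y, K (x - y) * f y) = fun ξ => 𝓕 f ξ * 𝓕 K ξ := by
    rw [he]
    exact funext fun ξ => Real.fourier_mul_convolution_eq hf hK ξ
  have hi : Integrable (fun x => ∫ y, K (x - y) * f y) := by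
    rw [he]; exact hf.integrable_convolution _ hK
  -- The transform of the convolution is a product of two `L²` functions.
  have hi' : Integrable (𝓕 (fun x => ∫ y, K (x - y) * f y)) := by
    rw [hF]
    exact (memLp_two_fourier hf hf2).integrable_mul hK2
  exact ⟨_, .of_fourierInv hi'.1 (by simpa [wt] using hi'.norm),
    fourierInv_fourier_ae_eq hi hi'⟩

/-! ### Logarithmic kernels: exponential integrability and bootstrap -/

/-- Integrable convolution kernels that are smooth away from the origin, have an at most logarithmic
singularity there, and gain `n` derivatives. -/
structure IsLogKernel (K : Rn n → ℂ) : Prop where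
  integrable : Integrable K
  fourier_bound : ∃ C, ∀ ξ, ‖𝓕 K ξ‖ * wt n ξ ≤ C
  exp_bound : ∃ l : ℝ, 0 < l ∧ ∃ C : ℝ, ∀ x, x ≠ 0 →
    Real.exp (l * ‖K x‖) ≤ C * (1 + ‖x‖ ^ (-(1 / 2) : ℝ))
  smooth_off : ∀ θ : Rn n → ℝ, IsTest θ → (∀ᶠ x in nhds 0, θ x = 1) →
    ContDiff ℝ ∞ (fun x => ((1 - θ x : ℝ) : ℂ) * K x) ∧
      ∀ k : ℕ, ∃ C, ∀ x, ‖iteratedFDeriv ℝ k (fun x => ((1 - θ x : ℝ) : ℂ) * K x) x‖ ≤ C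

/-- In polar coordinates the factor `r^(n-1)` is at most `1` on the unit ball, and `-1/2 > -1`. The
exponent `-1/2` is therefore admissible in every dimension, including `n = 1`. -/
theorem integrable_indicator_rpow_neg_half (hn : 1 ≤ n) :
    Integrable ((Metric.ball (0 : Rn n) 1).indicator fun z => ‖z‖ ^ (-(1 / 2) : ℝ)) := by
  have : Nonempty (Fin n) := ⟨⟨0, hn⟩⟩
  rw [integrable_indicator_iff measurableSet_ball]
  rw [integrableOn_fun_norm_addHaar volume (f := fun r : ℝ => r ^ (-(1 / 2) : ℝ))]
  have h : IntegrableOn (fun r : ℝ => r ^ (-(1 / 2) : ℝ)) (Set.Ioo 0 1) :=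
    (intervalIntegral.integrableOn_Ioo_rpow_iff one_pos).2 (by norm_num)
  refine Integrable.mono' h ?_ ?_
  · exact (continuous_id.pow _).aestronglyMeasurable.smul h.1
  · refine (ae_restrict_iff' measurableSet_Ioo).2 (Filter.Eventually.of_forall fun r hr => ?_)
    have h1 : 0 ≤ r ^ (-(1 / 2) : ℝ) := Real.rpow_nonneg hr.1.le _
    rw [norm_smul, Real.norm_of_nonneg h1, Real.norm_of_nonneg (pow_nonneg hr.1.le _)]
    exact mul_le_of_le_one_left h1 (pow_le_one₀ hr.1.le hr.2.le)

theorem rpow_neg_half_le (z : Rn n) : ‖z‖ ^ (-(1 / 2) : ℝ)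
    ≤ 1 + (Metric.ball (0 : Rn n) 1).indicator (fun z => ‖z‖ ^ (-(1 / 2) : ℝ)) z := by
  by_cases hz : z ∈ Metric.ball (0 : Rn n) 1
  · rw [Set.indicator_of_mem hz]; linarith
  · rw [Set.indicator_of_notMem hz, add_zero]
    exact Real.rpow_le_one_of_one_le_of_nonpos (by simpa using hz) (by norm_num)

/-- Exponential integrability of the potential of a small mass. -/
theorem integrableOn_exp_conv (hn : 1 ≤ n) {K : Rn n → ℂ} (hK : Integrable K) {l C : ℝ}
    (hexp : ∀ x, x ≠ 0 → Real.exp (l * ‖K x‖) ≤ C * (1 + ‖x‖ ^ (-(1 / 2) : ℝ)))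
    {f : Rn n → ℝ} (hf : Integrable f) (hf0 : ∀ x, 0 ≤ f x) {p : ℝ}
    (hpl : p * ∫ x, f x ≤ l) (R : ℝ) :
    IntegrableOn (fun x => Real.exp (p * ∫ y, ‖K (x - y)‖ * f y)) (Metric.ball 0 R) := by
  have : Nonempty (Fin n) := ⟨⟨0, hn⟩⟩
  set B := Metric.ball (0 : Rn n) R
  have hBfin : IsFiniteMeasure (volume.restrict B) := ⟨by
    rw [Measure.restrict_apply_univ]; exact measure_ball_lt_top⟩
  have hKf : Integrable (fun z : Rn n × Rn n => ‖K (z.1 - z.2)‖ * f z.2)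
      (volume.prod volume) := by
    refine (hf.convolution_integrand (ContinuousLinearMap.mul ℝ ℝ) hK.norm).congr
      (Filter.Eventually.of_forall fun z => ?_)
    simp [mul_comm]
  have hmeas : AEStronglyMeasurable (fun x => Real.exp (p * ∫ y, ‖K (x - y)‖ * f y)) volume :=
    Real.continuous_exp.comp_aestronglyMeasurable (hKf.integral_prod_left.1.const_mul p)
  set δ := ∫ x, f x with hδ
  have hδ0 : 0 ≤ δ := integral_nonneg hf0
  -- Jensen's inequality below is for the probability measure `f / δ`, so zero mass is treated
  -- apart.
  rcases hδ0.eq_or_lt with h0 | hδpos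
  · have hz : f =ᵐ[volume] 0 := (integral_eq_zero_iff_of_nonneg hf0 hf).1 h0.symm
    have hc : (fun x => Real.exp (p * ∫ y, ‖K (x - y)‖ * f y)) = fun _ => (1 : ℝ) := by
      ext x
      have : ∫ y, ‖K (x - y)‖ * f y = 0 := by
        refine integral_eq_zero_of_ae ?_
        filter_upwards [hz] with y hy
        simp [hy]
      simp [this]
    rw [hc]
    exact integrable_const _
  set q := (Metric.ball (0 : Rn n) 1).indicator fun z => ‖z‖ ^ (-(1 / 2) : ℝ)
  have hq : Integrable q := integrable_indicator_rpow_neg_half hn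
  set E : Rn n → ℝ := fun z => Real.exp (p * δ * ‖K z‖)
  have hEm : AEStronglyMeasurable E := Real.continuous_exp.comp_aestronglyMeasurable
    (hK.1.norm.const_mul _)
  have hC : 0 ≤ C := by
    obtain ⟨i⟩ : Nonempty (Fin n) := inferInstance
    have hne : (EuclideanSpace.single i 1 : Rn n) ≠ 0 := by simp
    have h1 := (Real.exp_pos _).trans_le (hexp _ hne)
    by_contra hC
    have h2 : 0 ≤ ‖(EuclideanSpace.single i 1 : Rn n)‖ ^ (-(1 / 2) : ℝ) :=
      Real.rpow_nonneg (norm_nonneg _) _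
    nlinarith
  have hEle : ∀ z, z ≠ 0 → E z ≤ C * (2 + q z) := by
    intro z hz
    have h1 : E z ≤ Real.exp (l * ‖K z‖) :=
      Real.exp_le_exp.2 (mul_le_mul_of_nonneg_right hpl (norm_nonneg _))
    refine h1.trans ((hexp z hz).trans (mul_le_mul_of_nonneg_left ?_ hC))
    linarith [rpow_neg_half_le z]
  set H : Rn n × Rn n → ℝ := fun z => f z.2 * E (z.1 - z.2)
  have hHm : AEStronglyMeasurable H (volume.prod volume) :=
    hf.1.convolution_integrand (ContinuousLinearMap.mul ℝ ℝ) hEm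
  have hmono : (volume.restrict B).prod (volume : Measure (Rn n)) ≤ volume.prod volume := by
    have := Measure.prod_restrict (μ := (volume : Measure (Rn n)))
      (ν := (volume : Measure (Rn n))) B Set.univ
    rw [Measure.restrict_univ] at this
    rw [this]
    exact Measure.restrict_le_self
  have habs : (volume.restrict B).prod (volume : Measure (Rn n)) ≪ volume.prod volume :=
    Measure.absolutelyContinuous_of_le hmono
  -- The bound on `E` holds off the origin only; the diagonal is a null set.
  have hsub : ∀ᵐ z : Rn n × Rn n ∂((volume.restrict B).prod volume), z.1 - z.2 ≠ 0 := by
    refine habs.ae_le ?_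
    have := (quasiMeasurePreserving_sub_of_right_invariant (volume : Measure (Rn n))
      (volume : Measure (Rn n))).ae (p := fun z => z ≠ 0) (Measure.ae_ne volume 0)
    exact this
  have hHi : Integrable H ((volume.restrict B).prod volume) := by
    have hA : Integrable (fun z : Rn n × Rn n => C * (2 * (1 * f z.2)))
        ((volume.restrict B).prod volume) :=
      (((integrable_const (1 : ℝ)).mul_prod hf).const_mul 2).const_mul C
    have hB : Integrable (fun z : Rn n × Rn n => C * (f z.2 * q (z.1 - z.2)))
        ((volume.restrict B).prod volume) := by
      refine Integrable.const_mul ?_ C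
      exact (hf.convolution_integrand (ContinuousLinearMap.mul ℝ ℝ) hq).mono_measure hmono
    refine (hA.add hB).mono' (hHm.mono_ac habs) ?_
    filter_upwards [hsub] with z hz
    rw [Real.norm_of_nonneg (mul_nonneg (hf0 _) (Real.exp_pos _).le)]
    have := mul_le_mul_of_nonneg_left (hEle _ hz) (hf0 z.2)
    simp only [Pi.add_apply]
    linarith
  refine (hHi.integral_prod_left.const_mul δ⁻¹).mono' hmeas.restrict ?_
  filter_upwards [hHi.prod_right_ae, ae_restrict_of_ae hKf.prod_right_ae] with x hx1 hx2
  rw [Real.norm_of_nonneg (Real.exp_pos _).le]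
  set T := p * ∫ y, ‖K (x - y)‖ * f y with hT
  -- Jensen's inequality by hand: the exponential lies above its tangent at the mean `T`. Integrated
  -- against `f`, the tangent gives exactly `δ * exp T`.
  have hle : ∀ y, Real.exp T * (p * δ * (‖K (x - y)‖ * f y) + (1 - T) * f y) ≤ H (x, y) := by
    intro y
    have h1 := Real.add_one_le_exp (p * δ * ‖K (x - y)‖ - T)
    have h2 : Real.exp (p * δ * ‖K (x - y)‖)
        = Real.exp T * Real.exp (p * δ * ‖K (x - y)‖ - T) := by
      rw [← Real.exp_add]; congr 1; ring
    simp only [H, E]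
    rw [h2]
    have h3 := mul_le_mul_of_nonneg_left h1 (mul_nonneg (hf0 y) (Real.exp_pos T).le)
    linarith
  have hint := integral_mono
    (((hx2.const_mul (p * δ)).add (hf.const_mul (1 - T))).const_mul (Real.exp T)) hx1 hle
  simp only [Pi.add_apply] at hint
  rw [integral_const_mul, integral_add (hx2.const_mul _) (hf.const_mul _), integral_const_mul,
    integral_const_mul, ← hδ] at hint
  have h4 : Real.exp T * (p * δ * (∫ y, ‖K (x - y)‖ * f y) + (1 - T) * δ) = δ * Real.exp T := by
    rw [hT]; ring
  rw [h4] at hint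
  rwa [le_inv_mul_iff₀ hδpos]

theorem exists_integral_indicator_lt {f : Rn n → ℝ} (hf : Integrable f) {ε : ℝ} (hε : 0 < ε) :
    ∃ M : ℕ, ∫ x, {x | (M : ℝ) < f x}.indicator f x < ε := by
  have hmeas : ∀ M : ℕ, AEStronglyMeasurable ({x | (M : ℝ) < f x}.indicator f) volume := fun M =>
    hf.1.indicator₀ (nullMeasurableSet_lt aemeasurable_const hf.1.aemeasurable)
  have := tendsto_integral_of_dominated_convergence (F := fun M : ℕ => {x | (M : ℝ) < f x}.indicator f)
    (f := fun _ => (0 : ℝ)) (fun x => ‖f x‖) hmeas hf.norm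
    (fun M => Filter.Eventually.of_forall fun x => norm_indicator_le_norm_self _ _)
    (Filter.Eventually.of_forall fun x => by
      obtain ⟨N, hN⟩ := exists_nat_ge (f x)
      refine tendsto_const_nhds.congr' ?_
      filter_upwards [Filter.eventually_ge_atTop N] with M hM
      rw [Set.indicator_of_notMem]
      simp only [Set.mem_ofPred_eq, not_lt]
      exact hN.trans (by exact_mod_cast hM))
  simp only [integral_zero] at this
  exact (this.eventually_lt_const hε).exists

/-- The Brezis–Merle argument. The part of `f` above a level `M` has mass small enough for
`integrableOn_exp_conv` with exponent `2c`. The part below `M` has potential at most `M ∫ ‖K‖`, and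
`S` is bounded on the ball, so `f²` is at most a constant times the exponential of the first
potential. -/
theorem IsLogKernel.integrableOn_sq (hn : 1 ≤ n) {K : Rn n → ℂ} (hK : IsLogKernel K)
    {u : Rn n → ℝ} {S : Rn n → ℂ} (hS : Continuous S) {C c : ℝ} (hC : 0 ≤ C) (hc : 0 ≤ c)
    (hf : Integrable fun x => C * Real.exp (c * u x))
    (h : ∀ᵐ x, (u x : ℂ) = S x + ∫ y, K (x - y) * ((C * Real.exp (c * u y) : ℝ) : ℂ)) (R : ℝ) :
    IntegrableOn (fun x => (C * Real.exp (c * u x)) ^ 2) (Metric.ball 0 R) := by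
  set f : Rn n → ℝ := fun x => C * Real.exp (c * u x) with hfdef
  have hf0 : ∀ x, 0 ≤ f x := fun x => mul_nonneg hC (Real.exp_pos _).le
  obtain ⟨l, hl, D, hexp⟩ := hK.exp_bound
  -- The mass needed satisfies `2c * mass ≤ l`; the `+ 1` keeps the threshold meaningful when `c =
  -- 0`.
  obtain ⟨M, hM⟩ := exists_integral_indicator_lt hf (ε := l / (2 * c + 1)) (by positivity)
  set s := {x | (M : ℝ) < f x}
  set f₁ := s.indicator f
  have hs : NullMeasurableSet s volume :=
    nullMeasurableSet_lt aemeasurable_const hf.1.aemeasurable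
  have hf₁ : Integrable f₁ := hf.indicator₀ hs
  have hf₁0 : ∀ x, 0 ≤ f₁ x := fun x => Set.indicator_nonneg (fun x _ => hf0 x) x
  have hsmall : 2 * c * ∫ x, f₁ x ≤ l := by
    have h0 : 0 ≤ ∫ x, f₁ x := integral_nonneg hf₁0
    rw [lt_div_iff₀ (by positivity)] at hM
    nlinarith
  have hE := integrableOn_exp_conv hn hK.integrable hexp hf₁ hf₁0 hsmall R
  obtain ⟨A, hA⟩ := (isCompact_closedBall (0 : Rn n) R).exists_bound_of_continuousOn
    hS.continuousOn
  set N := A + M * ∫ y, ‖K y‖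
  refine (hE.const_mul (C ^ 2 * Real.exp (2 * c * N))).mono'
    (hf.1.restrict.pow 2) ?_
  have hKf : Integrable (fun z : Rn n × Rn n => ‖K (z.1 - z.2)‖ * f₁ z.2)
      (volume.prod volume) := by
    refine (hf₁.convolution_integrand (ContinuousLinearMap.mul ℝ ℝ) hK.integrable.norm).congr
      (Filter.Eventually.of_forall fun z => ?_)
    simp [mul_comm]
  refine (ae_restrict_iff' measurableSet_ball).2 ?_
  filter_upwards [h, hKf.prod_right_ae] with x hx hx1 hxR
  have hu : u x ≤ N + ∫ y, ‖K (x - y)‖ * f₁ y := by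
    have e1 : u x ≤ ‖S x‖ + ‖∫ y, K (x - y) * ((f y : ℝ) : ℂ)‖ := by
      refine le_trans (le_abs_self _) ?_
      rw [← Real.norm_eq_abs, ← Complex.norm_real, hx]
      exact norm_add_le _ _
    have e2 : ‖∫ y, K (x - y) * ((f y : ℝ) : ℂ)‖
        ≤ ∫ y, (‖K (x - y)‖ * f₁ y + ‖K (x - y)‖ * M) := by
      refine norm_integral_le_of_norm_le
        (hx1.add ((hK.integrable.norm.comp_sub_left x).mul_const _))
        (Filter.Eventually.of_forall fun y => ?_)
      rw [norm_mul, Complex.norm_real, Real.norm_of_nonneg (hf0 y), ← mul_add]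
      refine mul_le_mul_of_nonneg_left ?_ (norm_nonneg _)
      by_cases hy : y ∈ s
      · simp only [f₁, Set.indicator_of_mem hy]
        linarith [(Nat.cast_nonneg M : (0 : ℝ) ≤ M)]
      · simp only [f₁, Set.indicator_of_notMem hy]
        simpa [s] using hy
    rw [integral_add hx1 ((hK.integrable.norm.comp_sub_left x).mul_const _), integral_mul_const,
      integral_sub_left_eq_self (fun y => ‖K y‖) volume x] at e2
    have e3 := hA x (Metric.ball_subset_closedBall hxR)
    simp only [N]
    linarith
  rw [Real.norm_of_nonneg (by positivity), mul_pow, ← Real.exp_nat_mul, mul_assoc (C ^ 2),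
    ← Real.exp_add]
  refine mul_le_mul_of_nonneg_left (Real.exp_le_exp.2 ?_) (by positivity)
  have := mul_le_mul_of_nonneg_left hu (by positivity : 0 ≤ 2 * c)
  push_cast
  linarith

theorem integrable_conv_integrand {K : Rn n → ℂ} (hK : Integrable K) {f : Rn n → ℂ}
    (hf : Integrable f) :
    Integrable (fun z : Rn n × Rn n => K (z.1 - z.2) * f z.2) (volume.prod volume) := by
  refine (hf.convolution_integrand (ContinuousLinearMap.mul ℂ ℂ) hK).congr
    (Filter.Eventually.of_forall fun z => ?_)
  simp [mul_comm]

theorem integrable_complex_ofReal {f : Rn n → ℝ} (hf : Integrable f) :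
    Integrable (fun x => (f x : ℂ)) := hf.ofReal

theorem IsTest.integrable_mul {θ f : Rn n → ℝ} (hθ : IsTest θ) (hf : Integrable f) :
    Integrable (fun x => θ x * f x) := by
  obtain ⟨C, hC⟩ := hθ.1.continuous.bounded_above_of_compact_support hθ.2
  exact hf.bdd_mul hθ.1.continuous.aestronglyMeasurable (Filter.Eventually.of_forall hC)

/-- Local regularity of `S + K * f` is determined by the potentials of compactly supported parts
of `f`. -/
theorem IsLogKernel.locA_of_conv {K : Rn n → ℂ} (hK : IsLogKernel K) {u f : Rn n → ℝ}
    {S : Rn n → ℂ} (hS : ContDiff ℝ ∞ S) (hf : Integrable f)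
    (h : ∀ᵐ x, (u x : ℂ) = S x + ∫ y, K (x - y) * (f y : ℂ)) {t : ℕ}
    (ht : ∀ θ : Rn n → ℝ, IsTest θ → ∃ g : Rn n → ℂ, MemA t g ∧
      (fun x => ∫ y, K (x - y) * ((θ y * f y : ℝ) : ℂ)) =ᵐ[volume] g) : LocA t u := by
  intro χ hχ
  obtain ⟨R, hR, hsupp⟩ := hχ.exists_support_subset_ball
  -- If `‖x‖ < R` and `θ y ≠ 1` then `‖x - y‖ ≥ 2`, where `κ` vanishes. In the far part of the
  -- potential `K` may thus be replaced by `(1 - κ) K`, which is smooth with bounded derivatives.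
  obtain ⟨θ, hθ, hθ1, -⟩ := exists_isTest_ball (n := n) (r := R + 2) (by positivity)
    (lt_add_one (R + 2))
  obtain ⟨κ, hκ, hκ1, hκ0, -⟩ := exists_isTest_ball (n := n) one_pos one_lt_two
  obtain ⟨hsm, hbd⟩ := hK.smooth_off κ hκ (by
    filter_upwards [Metric.isOpen_ball.mem_nhds (Metric.mem_ball_self one_pos)] with x hx
    exact hκ1 x hx)
  obtain ⟨g, hg, hgae⟩ := ht θ hθ
  have hθf : Integrable (fun x => θ x * f x) := hθ.integrable_mul hf
  have hθf' : Integrable (fun x => (1 - θ x) * f x) := by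
    refine (hf.sub hθf).congr (Filter.Eventually.of_forall fun x => ?_)
    simp only [Pi.sub_apply]
    ring
  set G : Rn n → ℂ := fun x =>
    ∫ y, (((1 - κ (x - y) : ℝ) : ℂ) * K (x - y)) * (((1 - θ y) * f y : ℝ) : ℂ)
  have hG : ContDiff ℝ ∞ G := contDiff_integral_mul_sub_of_bounded hθf' hsm hbd
  have hcd : ∀ T : Rn n → ℂ, ContDiff ℝ ∞ T → MemA t (fun x => (χ x : ℂ) * T x) := fun T hT =>
    .of_contDiff_hasCompactSupport t (hχ.ofReal_contDiff.mul hT)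
      (hχ.ofReal_hasCompactSupport.mul_right)
  refine ⟨_, ((hcd S hS).add ((hχ.memA t).mul hg)).add (hcd G hG), ?_⟩
  filter_upwards [h, hgae, (integrable_conv_integrand hK.integrable
    (integrable_complex_ofReal hθf)).prod_right_ae, (integrable_conv_integrand hK.integrable
    (integrable_complex_ofReal hθf')).prod_right_ae] with x hx hgx h1 h2
  by_cases hxR : x ∈ Metric.ball (0 : Rn n) R
  · have e1 : ∫ y, K (x - y) * (f y : ℂ) = (∫ y, K (x - y) * ((θ y * f y : ℝ) : ℂ))
        + ∫ y, K (x - y) * (((1 - θ y) * f y : ℝ) : ℂ) := by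
      rw [← integral_add h1 h2]
      refine integral_congr_ae (Filter.Eventually.of_forall fun y => ?_)
      simp only
      push_cast
      ring
    have e2 : ∫ y, K (x - y) * (((1 - θ y) * f y : ℝ) : ℂ) = G x := by
      refine integral_congr_ae (Filter.Eventually.of_forall fun y => ?_)
      simp only
      by_cases hy : y ∈ Metric.ball (0 : Rn n) (R + 2)
      · simp [hθ1 y hy]
      · have : x - y ∉ Metric.ball (0 : Rn n) 2 := by
          rw [mem_ball_zero_iff] at hxR hy ⊢
          have := norm_sub_norm_le y x
          rw [norm_sub_rev] at this
          linarith
        simp [hκ0 _ this]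
    rw [hx, e1, e2, hgx]
    ring
  · simp [hsupp x hxR]

/-- The square decays like `(1 + ‖ξ‖)^(-2n)`, and `2n > n`. -/
theorem memLp_two_of_mul_wt_le (hn : 1 ≤ n) {m : Rn n → ℂ} (hm : Continuous m) {C : ℝ}
    (h : ∀ ξ, ‖m ξ‖ * wt n ξ ≤ C) : MemLp m 2 := by
  rw [memLp_two_iff_integrable_sq_norm hm.aestronglyMeasurable]
  have hi : Integrable (fun ξ : Rn n => (1 + ‖ξ‖) ^ (-(2 * n : ℝ))) :=
    integrable_one_add_norm (by
      have : (1 : ℝ) ≤ n := by exact_mod_cast hn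
      simp only [finrank_euclideanSpace, Fintype.card_fin]
      linarith)
  refine (hi.const_mul (C ^ 2)).mono' (by fun_prop) (Filter.Eventually.of_forall fun ξ => ?_)
  have hw := wt_pos n ξ
  have h1 : (1 + ‖ξ‖) ^ (-(2 * n : ℝ)) = (wt n ξ ^ 2)⁻¹ := by
    rw [Real.rpow_neg (by positivity), wt, ← pow_mul, ← Real.rpow_natCast]
    congr 2
    push_cast
    ring
  rw [Real.norm_of_nonneg (by positivity), h1, ← div_eq_mul_inv, le_div_iff₀ (by positivity),
    ← mul_pow]
  exact pow_le_pow_left₀ (by positivity) (h ξ) 2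

/-- Regularity for `u = S + K * (C e^{cu})`. -/
theorem IsLogKernel.isSmooth_of_eq_add_conv_exp (hn : 1 ≤ n) {K : Rn n → ℂ} (hK : IsLogKernel K)
    {u : Rn n → ℝ} {S : Rn n → ℂ} (hS : ContDiff ℝ ∞ S) {C c : ℝ} (hC : 0 ≤ C) (hc : 0 ≤ c)
    (hf : Integrable fun x => C * Real.exp (c * u x))
    (h : ∀ᵐ x, (u x : ℂ) = S x + ∫ y, K (x - y) * ((C * Real.exp (c * u y) : ℝ) : ℂ)) :
    IsSmooth u := by
  obtain ⟨D, hD⟩ := hK.fourier_bound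
  have hK2 := memLp_two_of_mul_wt_le hn (continuous_fourier hK.integrable) hD
  -- Start of the bootstrap: local square integrability of the exponential and `𝓕 K ∈ L²` give order
  -- `0`.
  have h0 : LocA 0 u := by
    refine hK.locA_of_conv hS hf h fun θ hθ => ?_
    have hi : Integrable fun y => θ y * (C * Real.exp (c * u y)) := hθ.integrable_mul hf
    refine exists_memA_zero_conv hK.integrable hK2 (integrable_complex_ofReal hi) ?_
    suffices MemLp (fun y => θ y * (C * Real.exp (c * u y))) 2 from this.ofReal
    rw [memLp_two_iff_integrable_sq_norm hi.1]
    obtain ⟨R, hR, hsupp⟩ := hθ.exists_support_subset_ball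
    obtain ⟨A, hA⟩ := hθ.1.continuous.bounded_above_of_compact_support hθ.2
    have hsq := hK.integrableOn_sq hn hS.continuous hC hc hf h R
    rw [← integrable_indicator_iff measurableSet_ball] at hsq
    refine (hsq.const_mul (A ^ 2)).mono' (hi.1.norm.pow 2) (Filter.Eventually.of_forall fun x => ?_)
    by_cases hx : x ∈ Metric.ball (0 : Rn n) R
    · rw [Set.indicator_of_mem hx, norm_mul, mul_pow, norm_mul, norm_pow, norm_norm, norm_pow,
        norm_norm, Real.norm_of_nonneg (mul_nonneg hC (Real.exp_pos _).le)]
      exact mul_le_mul_of_nonneg_right (pow_le_pow_left₀ (norm_nonneg _) (hA x) 2) (by positivity)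
    · simp [hsupp x hx, hx]
  -- The exponential preserves the order `s`, and convolution with `K` adds `n`.
  have hstep : ∀ s, LocA s u → LocA (s + n) u := by
    intro s hs
    refine hK.locA_of_conv hS hf h fun θ hθ => ?_
    obtain ⟨g, hg, hae⟩ := hs.exp C c θ hθ
    refine ⟨_, hg.conv hK.integrable hD, Filter.Eventually.of_forall fun x => ?_⟩
    refine integral_congr_ae ?_
    filter_upwards [hae] with y hy
    rw [← hy]
    push_cast
    rfl
  have hall : ∀ k : ℕ, LocA (k * n) u := by
    intro k
    induction k with
    | zero => simpa using h0
    | succ k ih => rw [Nat.succ_mul]; exact hstep _ ih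
  exact isSmooth_of_forall_locA fun s => (hall s).mono (Nat.le_mul_of_pos_right s hn)

/-! ### Dyadic construction of the parametrix kernel -/

/-- A sum of smooth functions whose derivatives are uniformly geometrically bounded. -/
theorem contDiff_tsum_of_geometric {f : ℕ → Rn n → ℂ} (hf : ∀ j, ContDiff ℝ ∞ (f j)) {q : ℝ}
    (hq0 : 0 ≤ q) (hq : q < 1) {A : ℕ → ℝ}
    (hA : ∀ k j x, ‖iteratedFDeriv ℝ k (f j) x‖ ≤ A k * q ^ j) :
    ContDiff ℝ ∞ (fun x => ∑' j, f j x) ∧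
      ∀ k : ℕ, ∃ C, ∀ x, ‖iteratedFDeriv ℝ k (fun x => ∑' j, f j x) x‖ ≤ C := by
  have hs : ∀ k : ℕ, Summable fun j => A k * q ^ j := fun k =>
    (summable_geometric_of_lt_one hq0 hq).mul_left _
  refine ⟨contDiff_tsum (N := ⊤) hf (v := fun k j => A k * q ^ j) (fun k _ => hs k)
    (fun k j x _ => hA k j x), fun k => ⟨∑' j, A k * q ^ j, fun x => ?_⟩⟩
  rw [iteratedFDeriv_tsum_apply (N := ⊤) hf (v := fun k j => A k * q ^ j) (fun k _ => hs k)
    (fun k j x _ => hA k j x) le_top]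
  exact tsum_of_norm_bounded (hs k).hasSum fun j => hA k j x

/-- An even cutoff function, equal to `1` on the unit ball. -/
noncomputable def cutoff (n : ℕ) : ContDiffBump (0 : Rn n) := ⟨1, 2, one_pos, one_lt_two⟩

theorem cutoff_eq_one {ξ : Rn n} (h : ‖ξ‖ ≤ 1) : cutoff n ξ = 1 :=
  (cutoff n).one_of_mem_closedBall (by simpa [cutoff] using h)

theorem cutoff_eq_zero {ξ : Rn n} (h : 2 ≤ ‖ξ‖) : cutoff n ξ = 0 :=
  (cutoff n).zero_of_le_dist (by simpa [cutoff] using h)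

theorem isTest_cutoff : IsTest (cutoff n) := ⟨(cutoff n).contDiff, (cutoff n).hasCompactSupport⟩

/-- The symbol `|2πξ|^(-a)`. -/
noncomputable def rieszSymbol (a : ℝ) (ξ : Rn n) : ℝ := (2 * Real.pi * ‖ξ‖) ^ (-a)

/-- The Riesz symbol localized to a dyadic annulus. -/
noncomputable def annulusSymbol (a : ℝ) (ξ : Rn n) : ℝ :=
  rieszSymbol a ξ * (cutoff n ((1 / 2 : ℝ) • ξ) - cutoff n ξ)

/-- The Riesz symbol with low frequencies removed. -/
noncomputable def highSymbol (a : ℝ) (ξ : Rn n) : ℝ := rieszSymbol a ξ * (1 - cutoff n ξ)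

theorem rieszSymbol_neg (a : ℝ) (ξ : Rn n) : rieszSymbol a (-ξ) = rieszSymbol a ξ := by
  simp [rieszSymbol]

theorem annulusSymbol_neg (a : ℝ) (ξ : Rn n) : annulusSymbol a (-ξ) = annulusSymbol a ξ := by
  simp [annulusSymbol, rieszSymbol_neg, ContDiffBump.neg]

/-- The two cutoffs are both `1` on the unit ball, which hides the singularity of the Riesz symbol,
and both `0` outside radius `4`. -/
theorem isTest_annulusSymbol (a : ℝ) : IsTest (annulusSymbol (n := n) a) := by
  refine ⟨contDiff_iff_contDiffAt.2 fun ξ => ?_, ?_⟩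
  · by_cases hξ : ξ = 0
    · have : annulusSymbol (n := n) a =ᶠ[nhds ξ] fun _ => 0 := by
        filter_upwards [Metric.isOpen_ball.mem_nhds (show ξ ∈ Metric.ball (0 : Rn n) 1 by simp [hξ])]
          with x hx
        have hx : ‖x‖ ≤ 1 := (mem_ball_zero_iff.1 hx).le
        rw [annulusSymbol, cutoff_eq_one hx, cutoff_eq_one, sub_self, mul_zero]
        rw [norm_smul]
        norm_num
        linarith [norm_nonneg x]
      exact contDiffAt_const.congr_of_eventuallyEq this
    · refine ContDiffAt.mul ?_ ?_
      · refine ContDiffAt.rpow_const_of_ne (contDiffAt_const.mul (contDiffAt_norm ℝ hξ)) ?_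
        have := norm_pos_iff.2 hξ
        positivity
      · exact (((cutoff n).contDiff.comp (contDiff_const_smul _)).sub
          (cutoff n).contDiff).contDiffAt
  · refine HasCompactSupport.intro (isCompact_closedBall (0 : Rn n) 4) fun x hx => ?_
    have hx : 4 < ‖x‖ := by simpa using hx
    rw [annulusSymbol, cutoff_eq_zero (ξ := x) (by linarith), cutoff_eq_zero, sub_self, mul_zero]
    rw [norm_smul]
    norm_num
    linarith

/-- Homogeneity of degree `-a` of the Riesz symbol cancels the geometric factor, leaving a
difference of consecutive cutoffs that telescopes in `hasSum_annulusSymbol`. -/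
theorem geom_mul_annulusSymbol {a : ℝ} (j : ℕ) (ξ : Rn n) :
    ((2 : ℝ) ^ (-a)) ^ j * annulusSymbol a (((2 : ℝ) ^ j)⁻¹ • ξ)
      = rieszSymbol a ξ * (cutoff n (((2 : ℝ) ^ (j + 1))⁻¹ • ξ) - cutoff n (((2 : ℝ) ^ j)⁻¹ • ξ)) := by
  have h1 : rieszSymbol a (((2 : ℝ) ^ j)⁻¹ • ξ) = ((2 : ℝ) ^ j) ^ a * rieszSymbol a ξ := by
    rw [rieszSymbol, rieszSymbol, norm_smul, norm_inv, norm_pow, Real.norm_ofNat,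
      show 2 * Real.pi * (((2 : ℝ) ^ j)⁻¹ * ‖ξ‖) = ((2 : ℝ) ^ j)⁻¹ * (2 * Real.pi * ‖ξ‖) by ring,
      Real.mul_rpow (by positivity) (by positivity), Real.inv_rpow (by positivity),
      Real.rpow_neg (by positivity), inv_inv]
  have h2 : ((2 : ℝ) ^ (-a)) ^ j * ((2 : ℝ) ^ j) ^ a = 1 := by
    rw [← Real.rpow_natCast 2 j, ← Real.rpow_mul (by norm_num), ← Real.rpow_natCast _ j,
      ← Real.rpow_mul (by norm_num), ← Real.rpow_add (by norm_num)]
    simp [mul_comm]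
  rw [annulusSymbol, h1, smul_smul, show (1 / 2 : ℝ) * (2 ^ j)⁻¹ = (2 ^ (j + 1))⁻¹ by
    rw [pow_succ, mul_inv]; ring]
  linear_combination (rieszSymbol a ξ * (cutoff n (((2 : ℝ) ^ (j + 1))⁻¹ • ξ)
    - cutoff n (((2 : ℝ) ^ j)⁻¹ • ξ))) * h2

theorem two_rpow_neg_lt_one {a : ℝ} (ha : 0 < a) : (2 : ℝ) ^ (-a) < 1 :=
  Real.rpow_lt_one_of_one_lt_of_neg (by norm_num) (by linarith)

theorem norm_annulusSymbol_bounded (a : ℝ) : ∃ C, ∀ ξ : Rn n, ‖annulusSymbol a ξ‖ ≤ C :=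
  (isTest_annulusSymbol a).1.continuous.bounded_above_of_compact_support (isTest_annulusSymbol a).2

theorem hasSum_annulusSymbol {a : ℝ} (ha : 0 < a) (ξ : Rn n) :
    HasSum (fun j : ℕ => ((2 : ℝ) ^ (-a)) ^ j * annulusSymbol a (((2 : ℝ) ^ j)⁻¹ • ξ))
      (highSymbol a ξ) := by
  have hs : Summable fun j : ℕ => ((2 : ℝ) ^ (-a)) ^ j * annulusSymbol a (((2 : ℝ) ^ j)⁻¹ • ξ) := by
    obtain ⟨C, hC⟩ := norm_annulusSymbol_bounded (n := n) a
    refine Summable.of_norm_bounded ((summable_geometric_of_lt_one (by positivity)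
      (two_rpow_neg_lt_one ha)).mul_right C) fun j => ?_
    rw [norm_mul, norm_pow, Real.norm_of_nonneg (by positivity : (0 : ℝ) ≤ 2 ^ (-a))]
    exact mul_le_mul_of_nonneg_left (hC _) (by positivity)
  refine hs.hasSum_iff_tendsto_nat.2 ?_
  have hsum : ∀ N : ℕ, ∑ j ∈ Finset.range N,
      ((2 : ℝ) ^ (-a)) ^ j * annulusSymbol a (((2 : ℝ) ^ j)⁻¹ • ξ)
      = rieszSymbol a ξ * (cutoff n (((2 : ℝ) ^ N)⁻¹ • ξ) - cutoff n ξ) := by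
    intro N
    simp only [geom_mul_annulusSymbol, ← Finset.mul_sum]
    rw [Finset.sum_range_sub (fun j => cutoff n (((2 : ℝ) ^ j)⁻¹ • ξ))]
    simp
  simp only [hsum]
  refine tendsto_const_nhds.congr' ?_
  obtain ⟨N, hN⟩ := pow_unbounded_of_one_lt ‖ξ‖ (one_lt_two (α := ℝ))
  filter_upwards [Filter.eventually_ge_atTop N] with M hM
  rw [highSymbol, cutoff_eq_one (ξ := ((2 : ℝ) ^ M)⁻¹ • ξ)]
  rw [norm_smul, norm_inv, norm_pow, Real.norm_ofNat, inv_mul_le_iff₀ (by positivity), mul_one]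
  exact hN.le.trans (pow_le_pow_right₀ (by norm_num) hM)

/-- Dilation by `2^(-j)` does not increase derivatives, so the dyadic series converges geometrically
with all its derivatives. Multiplication by the symbol then preserves the Schwartz space, which
makes `highConv` an admissible test function. -/
theorem highSymbol_hasTemperateGrowth {a : ℝ} (ha : 0 < a) :
    (fun ξ : Rn n => (highSymbol a ξ : ℂ)).HasTemperateGrowth := by
  set η := (isTest_annulusSymbol (n := n) a).toSchwartz with hη
  set q : ℝ := 2 ^ (-a) with hq
  have hq0 : 0 ≤ q := by positivity
  have hq1 : q < 1 := two_rpow_neg_lt_one ha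
  have he : (fun ξ : Rn n => (highSymbol a ξ : ℂ))
      = fun ξ => ∑' j : ℕ, (q ^ j) • η (((2 : ℝ) ^ j)⁻¹ • ξ) := by
    ext ξ
    rw [← (hasSum_annulusSymbol ha ξ).tsum_eq, Complex.ofReal_tsum]
    refine tsum_congr fun j => ?_
    rw [hη, IsTest.toSchwartz_apply, Complex.real_smul, Complex.ofReal_mul]
  have hsm : ∀ j : ℕ, ContDiff ℝ ∞ fun ξ : Rn n => η (((2 : ℝ) ^ j)⁻¹ • ξ) := fun j =>
    (η.smooth ⊤).comp (contDiff_const_smul _)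
  have hbd : ∀ k : ℕ, ∃ C, ∀ x, ‖iteratedFDeriv ℝ k η x‖ ≤ C := fun k => by
    obtain ⟨C, -, hC⟩ := η.decay 0 k
    exact ⟨C, fun x => by simpa using hC x⟩
  choose A hA using hbd
  obtain ⟨h1, h2⟩ := contDiff_tsum_of_geometric
    (f := fun j ξ => (q ^ j) • η (((2 : ℝ) ^ j)⁻¹ • ξ)) (fun j => (hsm j).const_smul _) hq0 hq1
    (A := A) fun k j x => by
      have e1 : iteratedFDeriv ℝ k (fun ξ : Rn n => (q ^ j) • η (((2 : ℝ) ^ j)⁻¹ • ξ)) x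
          = (q ^ j) • iteratedFDeriv ℝ k (fun ξ : Rn n => η (((2 : ℝ) ^ j)⁻¹ • ξ)) x :=
        iteratedFDeriv_const_smul_apply' ((hsm j).of_le (by exact_mod_cast le_top)).contDiffAt
      rw [e1, iteratedFDeriv_comp_const_smul _ ((η.smooth k)), norm_smul, norm_smul,
        Real.norm_of_nonneg (by positivity), Real.norm_of_nonneg (by positivity), mul_comm]
      refine mul_le_mul_of_nonneg_right ?_ (by positivity)
      refine (mul_le_of_le_one_left (norm_nonneg _) ?_).trans (hA k _)
      exact pow_le_one₀ (by positivity) (inv_le_one_of_one_le₀ (one_le_pow₀ (by norm_num)))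
  rw [he]
  refine ⟨h1, fun k => ?_⟩
  obtain ⟨C, hC⟩ := h2 k
  exact ⟨0, C, fun x => by simpa using hC x⟩

/-- The inverse Fourier transform of the annulus symbol. -/
noncomputable def kernelPiece (n : ℕ) (a : ℝ) : 𝓢(Rn n, ℂ) :=
  𝓕⁻ (isTest_annulusSymbol (n := n) a).toSchwartz

theorem fourier_kernelPiece (a : ℝ) (ξ : Rn n) :
    𝓕 (kernelPiece n a : Rn n → ℂ) ξ = annulusSymbol a ξ := by
  rw [← SchwartzMap.fourier_coe, kernelPiece, FourierTransform.fourier_fourierInv_eq]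
  rfl

theorem kernelPiece_neg (a : ℝ) (x : Rn n) : kernelPiece n a (-x) = kernelPiece n a x := by
  have h : ∀ x, kernelPiece n a x = 𝓕⁻ (fun ξ : Rn n => (annulusSymbol a ξ : ℂ)) x := fun x => by
    rw [kernelPiece, SchwartzMap.fourierInv_coe]; rfl
  rw [h, h, Real.fourierInv_eq_fourier_neg, neg_neg, Real.fourierInv_eq_fourier_comp_neg]
  simp only [annulusSymbol_neg]

/-- The dyadic pieces of the kernel with symbol `highSymbol a`. -/
noncomputable def kernelTerm (a : ℝ) (j : ℕ) (x : Rn n) : ℂ :=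
  (((2 : ℝ) ^ n * 2 ^ (-a)) ^ j) • kernelPiece n a ((2 : ℝ) ^ j • x)

/-- The convolution kernel with symbol `highSymbol a`. -/
noncomputable def highKernel (a : ℝ) (x : Rn n) : ℂ := ∑' j, kernelTerm a j x

theorem highKernel_neg (a : ℝ) (x : Rn n) : highKernel a (-x) = highKernel a x := by
  simp only [highKernel, kernelTerm, smul_neg, kernelPiece_neg]

theorem integrable_kernelTerm (a : ℝ) (j : ℕ) : Integrable (kernelTerm (n := n) a j) :=
  ((kernelPiece n a).integrable.comp_smul (pow_ne_zero j two_ne_zero)).smul (𝕜 := ℝ) _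

theorem scale_integral {F : Type*} [NormedAddCommGroup F] [NormedSpace ℝ F] (a : ℝ) (j : ℕ)
    (h : Rn n → F) : (((2 : ℝ) ^ n * 2 ^ (-a)) ^ j) • ∫ x, h ((2 : ℝ) ^ j • x)
      = (((2 : ℝ) ^ (-a)) ^ j) • ∫ x, h x := by
  rw [Measure.integral_comp_smul, smul_smul, finrank_euclideanSpace, Fintype.card_fin,
    abs_of_nonneg (by positivity)]
  congr 1
  rw [mul_pow, ← pow_mul, ← pow_mul, mul_comm n j]
  field_simp

theorem integral_norm_kernelTerm (a : ℝ) (j : ℕ) : ∫ x, ‖kernelTerm (n := n) a j x‖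
    = ((2 : ℝ) ^ (-a)) ^ j * ∫ x, ‖kernelPiece n a x‖ := by
  have := scale_integral a j (fun x => ‖kernelPiece n a x‖)
  simp only [smul_eq_mul] at this
  rw [← this, ← integral_const_mul]
  refine integral_congr_ae (Filter.Eventually.of_forall fun x => ?_)
  simp only [kernelTerm]
  rw [norm_smul, Real.norm_of_nonneg (by positivity)]

theorem fourier_kernelTerm (a : ℝ) (j : ℕ) (ξ : Rn n) : 𝓕 (kernelTerm (n := n) a j) ξ
    = ((((2 : ℝ) ^ (-a)) ^ j * annulusSymbol a (((2 : ℝ) ^ j)⁻¹ • ξ) : ℝ) : ℂ) := by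
  rw [Complex.ofReal_mul, ← fourier_kernelPiece, Real.fourier_eq, Real.fourier_eq,
    ← Complex.real_smul, ← scale_integral, ← integral_smul]
  refine integral_congr_ae (Filter.Eventually.of_forall fun x => ?_)
  simp only [kernelTerm, inner_smul_left, inner_smul_right]
  rw [smul_comm]
  congr 3
  simp

theorem summable_integral_norm_kernelTerm {a : ℝ} (ha : 0 < a) :
    Summable fun j => ∫ x, ‖kernelTerm (n := n) a j x‖ := by
  simp only [integral_norm_kernelTerm]
  exact (summable_geometric_of_lt_one (by positivity) (two_rpow_neg_lt_one ha)).mul_right _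

theorem integrable_highKernel {a : ℝ} (ha : 0 < a) : Integrable (highKernel (n := n) a) :=
  (integrable_tsum_of_summable_integral_norm (integrable_kernelTerm a)
    (summable_integral_norm_kernelTerm ha)).1

theorem fourier_highKernel {a : ℝ} (ha : 0 < a) (ξ : Rn n) :
    𝓕 (highKernel (n := n) a) ξ = highSymbol a ξ := by
  have hae := (integrable_tsum_of_summable_integral_norm (integrable_kernelTerm (n := n) a)
    (summable_integral_norm_kernelTerm ha)).2.1
  rw [← (hasSum_annulusSymbol ha ξ).tsum_eq, Complex.ofReal_tsum]
  simp only [← fourier_kernelTerm, Real.fourier_eq]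
  rw [integral_tsum_of_summable_integral_norm
    (fun j => (Real.fourierIntegral_convergent_iff ξ).2 (integrable_kernelTerm a j))
    (by simpa using summable_integral_norm_kernelTerm ha)]
  refine integral_congr_ae ?_
  filter_upwards [hae] with x hx
  simp only [highKernel, Circle.smul_def, smul_eq_mul]
  rw [tsum_mul_left]

/-- Away from the origin the rapid decay of `kernelPiece` at the dilated point absorbs both the
factor `2^(nj)` and the powers of `2^j` created by differentiation, so that `2^(-aj)` remains and
the series converges with all derivatives. -/
theorem smooth_off_highKernel {a : ℝ} (ha : 0 < a) {θ : Rn n → ℝ} (hθ : IsTest θ)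
    (h1 : ∀ᶠ x in nhds 0, θ x = 1) :
    ContDiff ℝ ∞ (fun x => ((1 - θ x : ℝ) : ℂ) * highKernel a x) ∧
      ∀ k : ℕ, ∃ C, ∀ x,
        ‖iteratedFDeriv ℝ k (fun x => ((1 - θ x : ℝ) : ℂ) * highKernel a x) x‖ ≤ C := by
  obtain ⟨r, hr, hball⟩ := Metric.eventually_nhds_iff_ball.1 h1
  set T : Rn n → ℂ := fun x => ((1 - θ x : ℝ) : ℂ) with hT
  set q : ℝ := 2 ^ (-a) with hq
  set g := kernelPiece n a
  have hTs : ContDiff ℝ ∞ T := Complex.ofRealCLM.contDiff.comp (contDiff_const.sub hθ.1)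
  have hTb : ∀ i : ℕ, ∃ C, 0 ≤ C ∧ ∀ x, ‖iteratedFDeriv ℝ i T x‖ ≤ C := by
    intro i
    obtain ⟨C, -, hC⟩ := hθ.toSchwartz.decay 0 i
    have he : T = fun x => (1 : ℂ) - hθ.toSchwartz x := by ext x; simp [hT]
    refine ⟨1 + |C|, by positivity, fun x => ?_⟩
    rw [he]
    have h2 : iteratedFDeriv ℝ i (fun x => (1 : ℂ) - hθ.toSchwartz x) x
        = iteratedFDeriv ℝ i (fun _ => (1 : ℂ)) x - iteratedFDeriv ℝ i hθ.toSchwartz x :=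
      iteratedFDeriv_sub_apply contDiffAt_const (hθ.toSchwartz.smooth i).contDiffAt
    rw [h2]
    refine (norm_sub_le _ _).trans (add_le_add ?_ ?_)
    · rcases Nat.eq_zero_or_pos i with rfl | hi
      · simp
      · rw [iteratedFDeriv_const_of_ne hi.ne']; simp
    · exact le_trans (by simpa using hC x) (le_abs_self C)
  choose A hA0 hA using hTb
  have hgb : ∀ l N : ℕ, ∃ C, 0 < C ∧ ∀ x, ‖x‖ ^ N * ‖iteratedFDeriv ℝ l g x‖ ≤ C := fun l N =>
    g.decay N l
  choose D hD0 hD using hgb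
  have hgs : ∀ j : ℕ, ContDiff ℝ ∞ fun x : Rn n => g ((2 : ℝ) ^ j • x) := fun j =>
    (g.smooth ⊤).comp (contDiff_const_smul _)
  have hterm : ∀ j : ℕ, ContDiff ℝ ∞ (kernelTerm (n := n) a j) := fun j => (hgs j).const_smul _
  -- Decay of order `n + k` is used: `n` for the dilation factor, and `k ≥ l` for the derivatives.
  have hder : ∀ k l j : ℕ, l ≤ k → ∀ x : Rn n, r ≤ ‖x‖ →
      ‖iteratedFDeriv ℝ l (kernelTerm a j) x‖ ≤ (D l (n + k) / r ^ (n + k)) * q ^ j := by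
    intro k l j hlk x hx
    have e1 : iteratedFDeriv ℝ l (kernelTerm a j) x
        = (((2 : ℝ) ^ n * q) ^ j) • iteratedFDeriv ℝ l (fun x : Rn n => g ((2 : ℝ) ^ j • x)) x :=
      iteratedFDeriv_const_smul_apply' ((hgs j).of_le (by exact_mod_cast le_top)).contDiffAt
    rw [e1, iteratedFDeriv_comp_const_smul _ (g.smooth l), norm_smul, norm_smul,
      Real.norm_of_nonneg (by positivity), Real.norm_of_nonneg (by positivity)]
    have h2 := hD l (n + k) ((2 : ℝ) ^ j • x)
    rw [norm_smul, norm_pow, Real.norm_ofNat, mul_pow] at h2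
    have hle : ((2 : ℝ) ^ n) ^ j * ((2 : ℝ) ^ j) ^ l ≤ ((2 : ℝ) ^ j) ^ (n + k) := by
      rw [← pow_mul, mul_comm n j, pow_mul, ← pow_add]
      exact pow_le_pow_right₀ (one_le_pow₀ (by norm_num)) (by omega)
    rw [div_mul_eq_mul_div, le_div_iff₀ (by positivity)]
    set I := ‖iteratedFDeriv ℝ l g ((2 : ℝ) ^ j • x)‖
    calc (2 ^ n * q) ^ j * ((2 ^ j) ^ l * I) * r ^ (n + k)
        = q ^ j * ((((2 : ℝ) ^ n) ^ j * (2 ^ j) ^ l) * r ^ (n + k) * I) := by rw [mul_pow]; ring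
      _ ≤ q ^ j * ((((2 : ℝ) ^ j) ^ (n + k)) * ‖x‖ ^ (n + k) * I) := by gcongr
      _ ≤ q ^ j * D l (n + k) := by gcongr
      _ = D l (n + k) * q ^ j := by ring
  have he : (fun x => T x * highKernel a x) = fun x => ∑' j, T x * kernelTerm a j x := by
    ext x
    rw [highKernel, tsum_mul_left]
  rw [he]
  refine contDiff_tsum_of_geometric (fun j => hTs.mul (hterm j)) (q := q) (by positivity)
    (two_rpow_neg_lt_one ha) (A := fun k => ∑ i ∈ Finset.range (k + 1),
      (k.choose i : ℝ) * A i * (D (k - i) (n + k) / r ^ (n + k))) fun k j x => ?_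
  rcases lt_or_ge ‖x‖ r with hx | hx
  · have hz : (fun x => T x * kernelTerm a j x) =ᶠ[nhds x] fun _ => 0 := by
      filter_upwards [Metric.isOpen_ball.mem_nhds (mem_ball_zero_iff.2 hx)] with y hy
      simp [hT, hball y hy]
    rw [(hz.iteratedFDeriv ℝ k).eq_of_nhds]
    have : iteratedFDeriv ℝ k (fun _ : Rn n => (0 : ℂ)) x = 0 := by
      rw [iteratedFDeriv_fun_zero]; rfl
    rw [this, norm_zero]
    refine mul_nonneg (Finset.sum_nonneg fun i _ => ?_) (by positivity)
    have := hA0 i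
    have := hD0 (k - i) (n + k)
    positivity
  · refine (norm_iteratedFDeriv_mul_le hTs (hterm j) x (n := k) (by exact_mod_cast le_top)).trans ?_
    rw [Finset.sum_mul]
    refine Finset.sum_le_sum fun i _ => ?_
    rw [mul_assoc _ _ (q ^ j)]
    have := hA0 i
    exact mul_le_mul (mul_le_mul_of_nonneg_left (hA i x) (by positivity))
      (hder k (k - i) j (Nat.sub_le _ _) x hx) (norm_nonneg _) (by positivity)

/-- The first `J` terms are at most `1`; the later ones are dominated by a geometric series with sum
`2`. -/
theorem sum_inv_one_add_two_pow_mul {r : ℝ} {J : ℕ} (hJ : 1 ≤ 2 ^ J * r) (hr : 0 < r) :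
    Summable (fun j : ℕ => (1 + 2 ^ j * r)⁻¹) ∧ ∑' j : ℕ, (1 + 2 ^ j * r)⁻¹ ≤ J + 2 := by
  have h1 : ∀ j : ℕ, (1 + 2 ^ (j + J) * r)⁻¹ ≤ (1 / 2 : ℝ) ^ j := by
    intro j
    rw [one_div, inv_pow]
    refine inv_anti₀ (by positivity) ?_
    have : (2 : ℝ) ^ j * 1 ≤ 2 ^ j * (2 ^ J * r) := mul_le_mul_of_nonneg_left hJ (by positivity)
    rw [pow_add]
    linarith
  have h2 : Summable (fun j : ℕ => (1 + 2 ^ (j + J) * r)⁻¹) :=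
    Summable.of_nonneg_of_le (fun j => by positivity) h1 summable_geometric_two
  have h3 : Summable (fun j : ℕ => (1 + 2 ^ j * r)⁻¹) := (summable_nat_add_iff J).1 h2
  refine ⟨h3, ?_⟩
  rw [← h3.sum_add_tsum_nat_add J]
  refine add_le_add ?_ ?_
  · refine (Finset.sum_le_card_nsmul _ _ 1 fun j _ => inv_le_one_of_one_le₀ ?_).trans (by simp)
    have : 0 ≤ 2 ^ j * r := by positivity
    linarith
  · exact (h2.tsum_le_tsum h1 summable_geometric_two).trans tsum_geometric_two.le

/-- About `log₂ (1/‖x‖)` dyadic pieces contribute a bounded amount each and the others sum to a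
constant. The kernel is thus at most logarithmic, and a small multiple of it exponentiates to a
small negative power. -/
theorem exp_highKernel_bound (n : ℕ) : ∃ l : ℝ, 0 < l ∧ ∃ C : ℝ, ∀ x : Rn n, x ≠ 0 →
    Real.exp (l * ‖highKernel (n : ℝ) x‖) ≤ C * (1 + ‖x‖ ^ (-(1 / 2) : ℝ)) := by
  set g := kernelPiece n (n : ℝ) with hg
  obtain ⟨C0, hC0, h0⟩ := g.decay 0 0
  obtain ⟨C1, hC1, h1⟩ := g.decay 1 0
  simp only [pow_zero, one_mul, norm_iteratedFDeriv_zero, pow_one] at h0 h1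
  set C := C0 + C1
  have hC : 0 < C := by positivity
  have hgle : ∀ y, ‖g y‖ ≤ C * (1 + ‖y‖)⁻¹ := fun y => by
    rw [← div_eq_mul_inv, le_div_iff₀ (by positivity)]
    have := h0 y
    have := h1 y
    simp only [C]
    linarith
  have hterm : ∀ (j : ℕ) (x : Rn n), ‖kernelTerm (n : ℝ) j x‖ ≤ C * (1 + 2 ^ j * ‖x‖)⁻¹ := by
    intro j x
    -- At the critical order `a = n` the dilation factor and the decay of the symbol cancel.
    have hq : (2 : ℝ) ^ n * 2 ^ (-(n : ℝ)) = 1 := by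
      rw [Real.rpow_neg (by norm_num), Real.rpow_natCast]
      field_simp
    rw [kernelTerm, hq, one_pow, one_smul]
    refine (hgle _).trans (le_of_eq ?_)
    rw [norm_smul, norm_pow, Real.norm_ofNat]
  -- With this `l`, the bound `C (J + 2)` on the kernel exponentiates to `2 * 2^(J/2)`.
  refine ⟨Real.log 2 / 2 / C, by have := Real.log_pos one_lt_two; positivity, 4, fun x hx => ?_⟩
  have hr : 0 < ‖x‖ := norm_pos_iff.2 hx
  have hex : ∃ J : ℕ, 1 ≤ 2 ^ J * ‖x‖ := by
    obtain ⟨J, hJ⟩ := pow_unbounded_of_one_lt ‖x‖⁻¹ (one_lt_two (α := ℝ))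
    refine ⟨J, ?_⟩
    rw [inv_lt_iff_one_lt_mul₀ hr] at hJ
    exact hJ.le
  classical
  set J := Nat.find hex with hJdef
  obtain ⟨hs, hle⟩ := sum_inv_one_add_two_pow_mul (Nat.find_spec hex) hr
  have hK : ‖highKernel (n : ℝ) x‖ ≤ C * (J + 2) := by
    rw [highKernel]
    refine (tsum_of_norm_bounded (hs.mul_left C).hasSum fun j => hterm j x).trans ?_
    rw [tsum_mul_left]
    exact mul_le_mul_of_nonneg_left hle hC.le
  have hexp : Real.exp (Real.log 2 / 2 / C * ‖highKernel (n : ℝ) x‖)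
      ≤ 2 * ((2 : ℝ) ^ J) ^ (1 / 2 : ℝ) := by
    have e : (2 : ℝ) * ((2 : ℝ) ^ J) ^ (1 / 2 : ℝ) = Real.exp (Real.log 2 / 2 * (J + 2)) := by
      rw [← Real.rpow_natCast 2 J, ← Real.rpow_mul (by norm_num), Real.rpow_def_of_pos (by norm_num),
        show Real.log 2 / 2 * ((J : ℝ) + 2) = Real.log 2 + Real.log 2 * (J * (1 / 2)) by ring,
        Real.exp_add, Real.exp_log (by norm_num)]
    rw [e]
    refine Real.exp_le_exp.2 ?_
    have hl : 0 ≤ Real.log 2 / 2 / C := by have := Real.log_pos one_lt_two; positivity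
    calc Real.log 2 / 2 / C * ‖highKernel (n : ℝ) x‖ ≤ Real.log 2 / 2 / C * (C * (J + 2)) :=
          mul_le_mul_of_nonneg_left hK hl
      _ = Real.log 2 / 2 * (J + 2) := by field_simp
  refine hexp.trans ?_
  have hp : 0 ≤ ‖x‖ ^ (-(1 / 2) : ℝ) := Real.rpow_nonneg hr.le _
  rcases Nat.eq_zero_or_pos J with h | h
  · rw [h]
    simp
    linarith
  -- Minimality of `J` gives `2^J < 2/‖x‖`; it is weakened to `4/‖x‖` for the sake of an exact
  -- square root.
  · have hlt := Nat.find_min hex (m := J - 1) (by omega)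
    rw [not_le] at hlt
    have h4 : (2 : ℝ) ^ J ≤ 4 * ‖x‖⁻¹ := by
      rw [← div_eq_mul_inv, le_div_iff₀ hr]
      have : (2 : ℝ) ^ J = 2 * 2 ^ (J - 1) := by
        rw [← pow_succ', Nat.sub_add_cancel h]
      rw [this]
      linarith
    have h5 : ((2 : ℝ) ^ J) ^ (1 / 2 : ℝ) ≤ 2 * ‖x‖ ^ (-(1 / 2) : ℝ) := by
      refine (Real.rpow_le_rpow (by positivity) h4 (by norm_num)).trans (le_of_eq ?_)
      rw [Real.mul_rpow (by norm_num) (by positivity), Real.inv_rpow hr.le, ← Real.rpow_neg hr.le,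
        show (4 : ℝ) = 2 ^ (2 : ℝ) by norm_num, ← Real.rpow_mul (by norm_num)]
      norm_num
    linarith

theorem highSymbol_mul_wt_le (ξ : Rn n) : ‖(highSymbol (n : ℝ) ξ : ℂ)‖ * wt n ξ ≤ 1 := by
  rcases le_total ‖ξ‖ 1 with h | h
  · simp [highSymbol, cutoff_eq_one h]
  · have h1 : |1 - cutoff n ξ| ≤ 1 := by
      rw [abs_of_nonneg (by linarith [(cutoff n).le_one (x := ξ)])]
      linarith [(cutoff n).nonneg (x := ξ)]
    have h2 : rieszSymbol (n : ℝ) ξ * wt n ξ ≤ 1 := by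
      rw [rieszSymbol, wt, Real.rpow_neg (by positivity), Real.rpow_natCast,
        inv_mul_le_iff₀ (by positivity), mul_one]
      refine pow_le_pow_left₀ (by positivity) ?_ n
      have := Real.pi_gt_three
      nlinarith
    have h3 : 0 ≤ rieszSymbol (n : ℝ) ξ := by unfold rieszSymbol; positivity
    rw [Complex.norm_real, highSymbol, norm_mul, Real.norm_of_nonneg h3, Real.norm_eq_abs]
    calc rieszSymbol (n : ℝ) ξ * |1 - cutoff n ξ| * wt n ξ
        = (rieszSymbol (n : ℝ) ξ * wt n ξ) * |1 - cutoff n ξ| := by ring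
      _ ≤ 1 * 1 := mul_le_mul h2 h1 (abs_nonneg _) zero_le_one
      _ = 1 := one_mul 1

theorem isLogKernel_highKernel (hn : 1 ≤ n) : IsLogKernel (highKernel (n := n) (n : ℝ)) where
  integrable := integrable_highKernel (by exact_mod_cast hn)
  fourier_bound := ⟨1, fun ξ => by
    rw [fourier_highKernel (by exact_mod_cast hn)]
    exact highSymbol_mul_wt_le ξ⟩
  exp_bound := exp_highKernel_bound n
  smooth_off _ hθ h1 := smooth_off_highKernel (by exact_mod_cast hn) hθ h1

/-! ### Parametrix representation of solutions -/

theorem schwartz_eq_fourierInv (ψ : 𝓢(Rn n, ℂ)) (x : Rn n) :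
    ψ x = 𝓕⁻ (𝓕 (ψ : Rn n → ℂ)) x := by
  rw [← SchwartzMap.fourier_coe, ← SchwartzMap.fourierInv_coe,
    FourierTransform.fourierInv_fourier_eq]

theorem integrable_fourier_schwartz (ψ : 𝓢(Rn n, ℂ)) : Integrable (𝓕 (ψ : Rn n → ℂ)) := by
  rw [← SchwartzMap.fourier_coe]
  exact (𝓕 ψ).integrable

/-- Convolution with an integrable kernel as a Fourier multiplier on Schwartz functions. -/
theorem integral_kernel_mul_schwartz {K : Rn n → ℂ} (hK : Integrable K) (ψ : 𝓢(Rn n, ℂ))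
    (x : Rn n) : ∫ y, K (x - y) * ψ y = 𝓕⁻ (fun ξ => 𝓕 K ξ * 𝓕 (ψ : Rn n → ℂ) ξ) x := by
  rw [← integral_kernel_mul_fourierInv hK (integrable_fourier_schwartz ψ)]
  simp only [← schwartz_eq_fourierInv]

/-- The Schwartz function with Fourier transform `cutoff`. -/
noncomputable def lowKernel (n : ℕ) : 𝓢(Rn n, ℂ) := 𝓕⁻ (isTest_cutoff (n := n)).toSchwartz

theorem fourier_lowKernel (ξ : Rn n) : 𝓕 (lowKernel n : Rn n → ℂ) ξ = cutoff n ξ := by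
  rw [← SchwartzMap.fourier_coe, lowKernel, FourierTransform.fourier_fourierInv_eq]
  rfl

theorem lowKernel_neg (x : Rn n) : lowKernel n (-x) = lowKernel n x := by
  have h : ∀ x, lowKernel n x = 𝓕⁻ (fun ξ : Rn n => (cutoff n ξ : ℂ)) x := fun x => by
    rw [lowKernel, SchwartzMap.fourierInv_coe]; rfl
  rw [h, h, Real.fourierInv_eq_fourier_neg, neg_neg, Real.fourierInv_eq_fourier_comp_neg]
  simp only [ContDiffBump.neg]

/-- The Schwartz function `highKernel a * ψ`. -/
noncomputable def highConv (a : ℝ) (ψ : 𝓢(Rn n, ℂ)) : 𝓢(Rn n, ℂ) :=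
  𝓕⁻ (SchwartzMap.smulLeftCLM ℂ (fun ξ : Rn n => (highSymbol a ξ : ℂ)) (𝓕 ψ))

theorem fourier_highConv {a : ℝ} (ha : 0 < a) (ψ : 𝓢(Rn n, ℂ)) (ξ : Rn n) :
    𝓕 (highConv a ψ : Rn n → ℂ) ξ = highSymbol a ξ * 𝓕 (ψ : Rn n → ℂ) ξ := by
  rw [← SchwartzMap.fourier_coe, highConv, FourierTransform.fourier_fourierInv_eq,
    SchwartzMap.smulLeftCLM_apply_apply (highSymbol_hasTemperateGrowth ha), smul_eq_mul,
    SchwartzMap.fourier_coe]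

theorem highConv_apply {a : ℝ} (ha : 0 < a) (ψ : 𝓢(Rn n, ℂ)) (x : Rn n) :
    highConv a ψ x = ∫ y, highKernel a (x - y) * ψ y := by
  rw [integral_kernel_mul_schwartz (integrable_highKernel ha), schwartz_eq_fourierInv]
  refine congrArg (fun F : Rn n → ℂ => 𝓕⁻ F x) (funext fun ξ => ?_)
  rw [fourier_highConv ha, fourier_highKernel ha]

theorem rpow_mul_highSymbol (a : ℝ) (ξ : Rn n) :
    (2 * Real.pi * ‖ξ‖) ^ a * highSymbol a ξ = 1 - cutoff n ξ := by
  rw [highSymbol, rieszSymbol]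
  rcases eq_or_ne ξ 0 with rfl | hξ
  · simp [cutoff_eq_one]
  · have : 0 < 2 * Real.pi * ‖ξ‖ := by have := norm_pos_iff.2 hξ; positivity
    rw [← mul_assoc, ← Real.rpow_add this]
    simp

/-- The parametrix identity: on the Fourier side the symbols multiply to `1 - cutoff`, and the error
is convolution with a Schwartz function. -/
theorem fracLaplacian_highConv {s : ℝ} (hs : 0 < s) (ψ : 𝓢(Rn n, ℂ)) (x : Rn n) :
    fracLaplacian s (highConv (2 * s) ψ) x = ψ x - ∫ y, lowKernel n (x - y) * ψ y := by
  have h2 : 0 < 2 * s := by positivity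
  rw [integral_kernel_mul_schwartz (lowKernel n).integrable, fracLaplacian]
  have he : (fun ξ : Rn n => (((2 * Real.pi * ‖ξ‖) ^ (2 * s) : ℝ) : ℂ)
      * 𝓕 (highConv (2 * s) ψ : Rn n → ℂ) ξ)
      = fun ξ => 𝓕 (ψ : Rn n → ℂ) ξ + (-1) * (𝓕 (lowKernel n : Rn n → ℂ) ξ * 𝓕 (ψ : Rn n → ℂ) ξ) := by
    ext ξ
    have := rpow_mul_highSymbol (2 * s) ξ
    rw [fourier_highConv h2, ← mul_assoc, ← Complex.ofReal_mul, this, fourier_lowKernel]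
    push_cast
    ring
  have hi : Integrable (fun ξ => 𝓕 (lowKernel n : Rn n → ℂ) ξ * 𝓕 (ψ : Rn n → ℂ) ξ) := by
    refine (integrable_fourier_schwartz ψ).bdd_mul (c := 1) ?_ ?_
    · exact (continuous_fourier (lowKernel n).integrable).aestronglyMeasurable
    · refine Filter.Eventually.of_forall fun ξ => ?_
      rw [fourier_lowKernel, Complex.norm_real, Real.norm_of_nonneg (cutoff n).nonneg]
      exact (cutoff n).le_one
  rw [he, fourierInv_add' (integrable_fourier_schwartz ψ) (hi.const_mul _),
    fourierInv_const_mul, ← schwartz_eq_fourierInv]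
  ring

/-- Justifies Fubini for the low-frequency term, where `W` has only weighted integrability. -/
theorem integrable_mul_schwartz_conv {W : Rn n → ℝ} {p : ℝ} (hp : 0 ≤ p)
    (hWm : AEStronglyMeasurable W) (hW : Integrable fun x => |W x| / (1 + ‖x‖ ^ p))
    (ρ : 𝓢(Rn n, ℂ)) {ψ : Rn n → ℝ} (hψ : IsTest ψ) :
    Integrable (fun z : Rn n × Rn n => (ψ z.1 : ℂ) * (ρ (z.1 - z.2) * (W z.2 : ℂ)))
      (volume.prod volume) := by
  obtain ⟨C, hC, N, h⟩ := schwartz_decay_weight ρ 0 hp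
  simp only [norm_iteratedFDeriv_zero] at h
  have hi : Integrable (fun x => ‖ψ x‖ * (C * (1 + ‖x‖) ^ N)) := by
    refine Continuous.integrable_of_hasCompactSupport ?_ ?_
    · have := hψ.1.continuous
      fun_prop
    · exact hψ.2.norm.mul_right
  have hm : AEStronglyMeasurable (fun z : Rn n × Rn n => (ψ z.1 : ℂ) * (ρ (z.1 - z.2) * (W z.2 : ℂ)))
      (volume.prod volume) := by
    have h1 : AEStronglyMeasurable (fun z : Rn n × Rn n => (W z.2 : ℂ)) (volume.prod volume) :=
      Complex.continuous_ofReal.comp_aestronglyMeasurable hWm.comp_snd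
    have h2 : Continuous (fun z : Rn n × Rn n => (ψ z.1 : ℂ)) :=
      Complex.continuous_ofReal.comp (hψ.1.continuous.comp continuous_fst)
    have h3 : Continuous (fun z : Rn n × Rn n => ρ (z.1 - z.2)) :=
      ρ.continuous.comp (by fun_prop)
    exact h2.aestronglyMeasurable.mul (h3.aestronglyMeasurable.mul h1)
  refine (hi.mul_prod hW).mono' hm (Filter.Eventually.of_forall fun z => ?_)
  rw [norm_mul, norm_mul, Complex.norm_real, Complex.norm_real, Real.norm_eq_abs (W z.2), mul_assoc]
  refine mul_le_mul_of_nonneg_left ?_ (norm_nonneg _)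
  calc ‖ρ (z.1 - z.2)‖ * |W z.2|
      ≤ (C * (1 + ‖z.1‖) ^ N * (1 / (1 + ‖z.2‖ ^ p))) * |W z.2| :=
        mul_le_mul_of_nonneg_right (h _ _) (abs_nonneg _)
    _ = _ := by ring

theorem integrable_conv {K : Rn n → ℂ} (hK : Integrable K) {f : Rn n → ℂ} (hf : Integrable f) :
    Integrable (fun x => ∫ y, K (x - y) * f y) :=
  (integrable_conv_integrand hK hf).integral_prod_left

theorem integrable_test_mul_conv {K : Rn n → ℂ} (hK : Integrable K) {f : Rn n → ℂ}
    (hf : Integrable f) {ψ : Rn n → ℂ} (hψ : Continuous ψ) {C : ℝ} (hC : ∀ x, ‖ψ x‖ ≤ C) :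
    Integrable (fun z : Rn n × Rn n => ψ z.1 * (K (z.1 - z.2) * f z.2)) (volume.prod volume) :=
  (integrable_conv_integrand hK hf).bdd_mul (c := C)
    (hψ.comp continuous_fst).aestronglyMeasurable (Filter.Eventually.of_forall fun z => hC z.1)

/-- Convolution with an even kernel is symmetric. -/
theorem integral_mul_conv_comm {K : Rn n → ℂ} (hKn : ∀ x, K (-x) = K x) {f ψ : Rn n → ℂ}
    (h : Integrable (fun z : Rn n × Rn n => ψ z.1 * (K (z.1 - z.2) * f z.2))
      (volume.prod volume)) :
    ∫ x, ψ x * ∫ y, K (x - y) * f y = ∫ y, f y * ∫ x, K (y - x) * ψ x := by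
  simp only [← integral_const_mul]
  rw [integral_integral_swap h]
  refine integral_congr_ae (Filter.Eventually.of_forall fun y => ?_)
  refine integral_congr_ae (Filter.Eventually.of_forall fun x => ?_)
  simp only
  rw [← hKn (x - y), neg_sub]
  ring

/-- The parametrix representation of solutions of `(-Δ)^s W = f`. -/
theorem exists_contDiff_add_conv {s : ℝ} (hs : 0 < s) {W f : Rn n → ℝ} (hW : MemL s W)
    (hf : Integrable f)
    (h : ∀ φ : 𝓢(Rn n, ℂ), ∫ x, (W x : ℂ) * fracLaplacian s φ x = ∫ x, (f x : ℂ) * φ x) :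
    ∃ S : Rn n → ℂ, ContDiff ℝ ∞ S ∧
      ∀ᵐ x, (W x : ℂ) = S x + ∫ y, highKernel (2 * s) (x - y) * (f y : ℂ) := by
  have h2 : 0 < 2 * s := by positivity
  have hp : 0 ≤ (n : ℝ) + 2 * s := by positivity
  have hWm := hW.1.aestronglyMeasurable
  have hS := contDiff_integral_schwartz_mul_sub hp hWm hW.2 (lowKernel n)
  have hK := integrable_highKernel (n := n) h2
  have hf' := integrable_complex_ofReal hf
  refine ⟨_, hS, ?_⟩
  have hWc : LocallyIntegrable (fun x => (W x : ℂ)) := fun x => by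
    obtain ⟨U, hU, hi⟩ := hW.1 x
    exact ⟨U, hU, hi.ofReal⟩
  refine ae_eq_of_integral_contDiff_smul_eq hWc
    (hS.continuous.locallyIntegrable.add (integrable_conv hK hf').locallyIntegrable)
    fun φ h1 h2' => ?_
  have hφ : IsTest φ := ⟨h1, h2'⟩
  set ψ := hφ.toSchwartz with hψ
  obtain ⟨C, hC⟩ := h1.continuous.bounded_above_of_compact_support h2'
  have hlow := integrable_mul_schwartz_conv hp hWm hW.2 (lowKernel n) hφ
  have hhigh := integrable_test_mul_conv hK hf' (ψ := fun x => (φ x : ℂ))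
    (Complex.continuous_ofReal.comp h1.continuous) (C := C) (fun x => by simpa using hC x)
  -- The equation is tested with `highKernel * ψ`, which is Schwartz but in general not compactly
  -- supported. Evenness of both kernels then moves the convolutions onto `W` and `f`.
  have key := h (highConv (2 * s) ψ)
  simp only [fracLaplacian_highConv hs, highConv_apply h2, mul_sub] at key
  have hW1 : Integrable (fun x => (W x : ℂ) * ψ x) := by
    have := hWc.integrable_smul_left_of_hasCompactSupport
      (Complex.continuous_ofReal.comp h1.continuous) hφ.ofReal_hasCompactSupport
    refine this.congr (Filter.Eventually.of_forall fun x => ?_)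
    simp [hψ, mul_comm]
  have hW2 : Integrable (fun x => (W x : ℂ) * ∫ y, lowKernel n (x - y) * ψ y) := by
    refine hlow.integral_prod_right.congr (Filter.Eventually.of_forall fun y => ?_)
    simp only [← integral_const_mul]
    refine integral_congr_ae (Filter.Eventually.of_forall fun x => ?_)
    simp only [hψ, IsTest.toSchwartz_apply]
    rw [← lowKernel_neg (x - y), neg_sub]
    ring
  rw [integral_sub hW1 hW2] at key
  have e1 := integral_mul_conv_comm (K := lowKernel n) (f := fun x => (W x : ℂ))
    (ψ := fun x => (φ x : ℂ)) lowKernel_neg hlow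
  have e2 := integral_mul_conv_comm (K := highKernel (2 * s)) (f := fun x => (f x : ℂ))
    (ψ := fun x => (φ x : ℂ)) (highKernel_neg _) hhigh
  have hA : Integrable (fun x => (φ x : ℂ) * ∫ y, lowKernel n (x - y) * (W y : ℂ)) := by
    refine hlow.integral_prod_left.congr (Filter.Eventually.of_forall fun x => ?_)
    exact integral_const_mul (φ x : ℂ) _
  have hB : Integrable (fun x => (φ x : ℂ) * ∫ y, highKernel (2 * s) (x - y) * (f y : ℂ)) := by
    refine hhigh.integral_prod_left.congr (Filter.Eventually.of_forall fun x => ?_)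
    exact integral_const_mul (φ x : ℂ) _
  have e3 : ∫ x, φ x • (W x : ℂ) = ∫ x, (W x : ℂ) * ψ x := by
    refine integral_congr_ae (Filter.Eventually.of_forall fun x => ?_)
    simp [hψ, mul_comm]
  have e4 : ∫ x, φ x • ((∫ y, lowKernel n (x - y) * (W y : ℂ))
      + ∫ y, highKernel (2 * s) (x - y) * (f y : ℂ))
      = (∫ x, (φ x : ℂ) * ∫ y, lowKernel n (x - y) * (W y : ℂ))
        + ∫ x, (φ x : ℂ) * ∫ y, highKernel (2 * s) (x - y) * (f y : ℂ) := by
    rw [← integral_add hA hB]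
    refine integral_congr_ae (Filter.Eventually.of_forall fun x => ?_)
    simp only [Complex.real_smul, mul_add]
  have e5 : (∫ x, (φ x : ℂ) * ∫ y, highKernel (2 * s) (x - y) * (f y : ℂ))
      = ∫ y, (f y : ℂ) * ∫ x, highKernel (2 * s) (y - x) * ψ x := e2
  have e6 : (∫ x, (φ x : ℂ) * ∫ y, lowKernel n (x - y) * (W y : ℂ))
      = ∫ y, (W y : ℂ) * ∫ x, lowKernel n (y - x) * ψ x := e1
  rw [e3]
  refine Eq.trans ?_ e4.symm
  rw [e5, e6, ← key]
  ring

/-! ### Weyl's lemma for powers of the Laplacian, by Fourier decay -/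

/-- Complex-valued test functions. -/
def IsCTest (φ : Rn n → ℂ) : Prop := ContDiff ℝ ∞ φ ∧ HasCompactSupport φ

/-- The partial derivative in the `i`-th coordinate direction. -/
noncomputable def pderiv (i : Fin n) (f : Rn n → ℂ) (x : Rn n) : ℂ :=
  fderiv ℝ f x (EuclideanSpace.single i 1)

/-- The character `x ↦ e^{-2πi x·ξ}`. -/
noncomputable def charFn (ξ x : Rn n) : ℂ := Real.fourierChar (-inner ℝ x ξ)

/-- The symbol of the Laplacian. -/
noncomputable def lapSymbol (ξ : Rn n) : ℂ := ((-(2 * Real.pi * ‖ξ‖) ^ 2 : ℝ) : ℂ)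

theorem contDiff_pderiv {f : Rn n → ℂ} (hf : ContDiff ℝ ∞ f) (i : Fin n) :
    ContDiff ℝ ∞ (pderiv i f) :=
  (hf.fderiv_right (m := ∞) (by simp)).clm_apply contDiff_const

theorem laplacian_eq_sum_pderiv {f : Rn n → ℂ} (hf : ContDiff ℝ ∞ f) :
    Δ f = fun x => ∑ i, pderiv i (pderiv i f) x := by
  rw [InnerProductSpace.laplacian_eq_iteratedFDeriv_orthonormalBasis f
    (EuclideanSpace.basisFun (Fin n) ℝ)]
  ext x
  refine Finset.sum_congr rfl fun i _ => ?_
  have hd : DifferentiableAt ℝ (fderiv ℝ f) x :=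
    (hf.fderiv_right (m := ∞) (by simp)).differentiable (by simp) x
  rw [iteratedFDeriv_two_apply]
  unfold pderiv
  rw [fderiv_clm_apply hd (differentiableAt_const _)]
  simp

theorem contDiff_laplacian {f : Rn n → ℂ} (hf : ContDiff ℝ ∞ f) : ContDiff ℝ ∞ (Δ f) := by
  rw [laplacian_eq_sum_pderiv hf]
  exact ContDiff.sum fun i _ => contDiff_pderiv (contDiff_pderiv hf i) i

theorem IsCTest.pderiv {φ : Rn n → ℂ} (hφ : IsCTest φ) (i : Fin n) : IsCTest (pderiv i φ) :=
  ⟨contDiff_pderiv hφ.1 i, hφ.2.fderiv_apply ℝ _⟩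

theorem contDiff_charFn (ξ : Rn n) : ContDiff ℝ ∞ (charFn ξ) := by
  have : charFn ξ = fun x => Complex.exp ((2 * Real.pi * (-inner ℝ x ξ) : ℝ) * Complex.I) := by
    ext x
    rw [charFn, Real.fourierChar_apply]
  rw [this]
  exact ContDiff.cexp (ContDiff.mul (Complex.ofRealCLM.contDiff.comp
    (contDiff_const.mul (contDiff_id.inner ℝ contDiff_const).neg)) contDiff_const)

theorem norm_charFn (ξ x : Rn n) : ‖charFn ξ x‖ = 1 := Circle.norm_coe _

theorem pderiv_charFn (i : Fin n) (ξ : Rn n) :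
    pderiv i (charFn ξ) = fun x => (-(2 * Real.pi * ξ i : ℝ) * Complex.I) * charFn ξ x := by
  ext x
  refine (Real.fderiv_fourierChar_neg_bilinear_left_apply (innerSL ℝ) x
    (EuclideanSpace.single i 1) ξ).trans ?_
  rw [innerSL_apply_apply, innerSL_apply_apply, EuclideanSpace.inner_single_left, charFn]
  simp
  ring

theorem pderiv_mul {f g : Rn n → ℂ} (hf : ContDiff ℝ ∞ f) (hg : ContDiff ℝ ∞ g) (i : Fin n) :
    pderiv i (fun x => f x * g x) = fun x => pderiv i f x * g x + f x * pderiv i g x := by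
  ext x
  rw [pderiv, fderiv_fun_mul (hf.differentiable (by simp) x) (hg.differentiable (by simp) x)]
  simp [pderiv]
  ring

theorem pderiv_add {f g : Rn n → ℂ} (hf : ContDiff ℝ ∞ f) (hg : ContDiff ℝ ∞ g) (i : Fin n) :
    pderiv i (fun x => f x + g x) = fun x => pderiv i f x + pderiv i g x := by
  ext x
  rw [pderiv, fderiv_fun_add (hf.differentiable (by simp) x) (hg.differentiable (by simp) x)]
  rfl

theorem pderiv_const_mul {f : Rn n → ℂ} (hf : ContDiff ℝ ∞ f) (c : ℂ) (i : Fin n) :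
    pderiv i (fun x => c * f x) = fun x => c * pderiv i f x := by
  ext x
  rw [pderiv, fderiv_const_mul (hf.differentiable (by simp) x)]
  rfl

/-- Families `F ξ` of test functions modulated by the character of frequency `ξ`, with
coefficients of growth `|ξ|^d`. -/
inductive IsModulated (d : ℕ) : (Rn n → Rn n → ℂ) → Prop
  | single (c : Rn n → ℂ) (ψ : Rn n → ℂ) (hψ : IsCTest ψ) (C : ℝ)
      (hc : ∀ ξ, ‖c ξ‖ ≤ C * wt d ξ) : IsModulated d (fun ξ x => c ξ * (ψ x * charFn ξ x))
  | add (F G : Rn n → Rn n → ℂ) (hF : IsModulated d F) (hG : IsModulated d G) :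
      IsModulated d (fun ξ x => F ξ x + G ξ x)

namespace IsModulated

variable {d : ℕ} {F : Rn n → Rn n → ℂ}

theorem contDiff (hF : IsModulated d F) (ξ : Rn n) : ContDiff ℝ ∞ (F ξ) := by
  induction hF with
  | single c ψ hψ C hc => exact contDiff_const.mul (hψ.1.mul (contDiff_charFn ξ))
  | add F G _ _ hF hG => exact hF.add hG

theorem zero (d : ℕ) : IsModulated d (fun (_ _ : Rn n) => (0 : ℂ)) := by
  convert single (d := d) (n := n) (fun _ => 0) (fun _ => 0) ⟨contDiff_const, .zero⟩ 0
    (fun ξ => by simp) using 3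
  simp

theorem sum {ι : Type*} (s : Finset ι) {F : ι → Rn n → Rn n → ℂ}
    (hF : ∀ i ∈ s, IsModulated d (F i)) : IsModulated d (fun ξ x => ∑ i ∈ s, F i ξ x) := by
  classical
  induction s using Finset.induction_on with
  | empty => simpa using zero d
  | insert i s hi ih =>
    simp only [Finset.sum_insert hi]
    exact add _ _ (hF i (Finset.mem_insert_self i s))
      (ih fun j hj => hF j (Finset.mem_insert_of_mem hj))

theorem mul_symbol (hF : IsModulated d F) {e : ℕ} {c : Rn n → ℂ} {C : ℝ}
    (hc : ∀ ξ, ‖c ξ‖ ≤ C * wt e ξ) : IsModulated (d + e) (fun ξ x => c ξ * F ξ x) := by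
  induction hF with
  | single b ψ hψ B hb =>
    convert single (fun ξ => c ξ * b ξ) ψ hψ (C * B) (d := d + e) (fun ξ => ?_) using 3
    · ring
    · have h1 : wt (d + e) ξ = wt d ξ * wt e ξ := pow_add _ _ _
      rw [norm_mul, h1]
      calc ‖c ξ‖ * ‖b ξ‖ ≤ (C * wt e ξ) * (B * wt d ξ) :=
            mul_le_mul (hc ξ) (hb ξ) (norm_nonneg _) ((norm_nonneg _).trans (hc ξ))
        _ = _ := by ring
  | add F G _ _ hF hG =>
    simp only [mul_add]
    exact add _ _ hF hG

theorem mono (hF : IsModulated d F) {e : ℕ} (h : d ≤ e) : IsModulated e F := by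
  obtain ⟨k, rfl⟩ := Nat.exists_eq_add_of_le h
  convert hF.mul_symbol (e := k) (c := fun _ => 1) (C := 1) (fun ξ => by
    simpa using one_le_wt k ξ) using 3
  simp

theorem norm_freq_le (i : Fin n) (ξ : Rn n) :
    ‖(-(2 * Real.pi * ξ i : ℝ) * Complex.I : ℂ)‖ ≤ 2 * Real.pi * wt 1 ξ := by
  have h1 : |ξ i| ≤ ‖ξ‖ := by simpa using PiLp.norm_apply_le ξ i
  rw [norm_mul, Complex.norm_I, mul_one, norm_neg, Complex.norm_real, Real.norm_eq_abs, abs_mul,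
    abs_of_pos (by positivity : 0 < 2 * Real.pi), wt, pow_one]
  refine mul_le_mul_of_nonneg_left ?_ (by positivity)
  linarith

theorem pderiv (hF : IsModulated d F) (i : Fin n) :
    IsModulated (d + 1) (fun ξ => pderiv i (F ξ)) := by
  induction hF with
  | single c ψ hψ C hc =>
    have h1 := (single c _ (hψ.pderiv i) C hc).mono (Nat.le_succ d)
    have h2 := (single c _ hψ C hc).mul_symbol (norm_freq_le i)
    convert add _ _ h1 h2 using 2 with ξ
    rw [pderiv_const_mul (hψ.1.mul (contDiff_charFn ξ)), pderiv_mul hψ.1 (contDiff_charFn ξ),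
      pderiv_charFn]
    ext x
    ring
  | add F G hF hG hF' hG' =>
    convert add _ _ hF' hG' using 2 with ξ
    exact pderiv_add (hF.contDiff ξ) (hG.contDiff ξ) i

theorem laplacian (hF : IsModulated d F) : IsModulated (d + 2) (fun ξ => Δ (F ξ)) := by
  have h : (fun ξ => Δ (F ξ)) = fun ξ x => ∑ i, ConformalQ.pderiv i (ConformalQ.pderiv i (F ξ)) x :=
    funext fun ξ => laplacian_eq_sum_pderiv (hF.contDiff ξ)
  rw [h]
  exact sum _ fun i _ => (hF.pderiv i).pderiv i

end IsModulated

theorem norm_lapSymbol_pow_le (k : ℕ) (ξ : Rn n) :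
    ‖lapSymbol ξ ^ k‖ ≤ ((2 * Real.pi) ^ 2) ^ k * wt (2 * k) ξ := by
  have : ‖ξ‖ ^ (2 * k) ≤ wt (2 * k) ξ :=
    pow_le_pow_left₀ (norm_nonneg _) (by linarith [norm_nonneg ξ]) _
  rw [norm_pow, lapSymbol, Complex.norm_real, norm_neg, norm_pow,
    Real.norm_of_nonneg (by positivity), mul_pow, mul_pow, ← pow_mul ‖ξ‖]
  exact mul_le_mul_of_nonneg_left this (by positivity)

/-- By Leibniz, both derivatives falling on the character give `lapSymbol ξ`; every other term
carries at most one factor of `ξ`. -/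
theorem isModulated_laplacian_sub {ψ : Rn n → ℂ} (hψ : IsCTest ψ) :
    IsModulated 1 (fun ξ x => Δ (fun y => ψ y * charFn ξ y) x
      - lapSymbol ξ * (ψ x * charFn ξ x)) := by
  have h1 : ∀ i : Fin n, IsModulated 1 (fun ξ x =>
      1 * (pderiv i (pderiv i ψ) x * charFn ξ x)
        + 2 * (-(2 * Real.pi * ξ i : ℝ) * Complex.I) * (pderiv i ψ x * charFn ξ x)) := fun i => by
    refine .add _ _ (.single (fun _ => 1) _ ((hψ.pderiv i).pderiv i) 1
      fun ξ => by simpa using one_le_wt 1 ξ) (.single _ _ (hψ.pderiv i) (2 * (2 * Real.pi))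
      fun ξ => ?_)
    rw [norm_mul, Complex.norm_ofNat]
    linarith [IsModulated.norm_freq_le i ξ]
  convert IsModulated.sum Finset.univ fun i _ => h1 i using 1
  ext ξ x
  have hs : lapSymbol ξ = ∑ i, (-(2 * Real.pi * ξ i : ℝ) * Complex.I) ^ 2 := by
    rw [lapSymbol, mul_pow, EuclideanSpace.real_norm_sq_eq, Finset.mul_sum, ← Finset.sum_neg_distrib,
      Complex.ofReal_sum]
    refine Finset.sum_congr rfl fun i _ => ?_
    push_cast
    linear_combination (-(2 * Real.pi * (ξ i : ℂ)) ^ 2) * Complex.I_sq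
  rw [laplacian_eq_sum_pderiv (hψ.1.mul (contDiff_charFn ξ)), hs, Finset.sum_mul,
    ← Finset.sum_sub_distrib]
  refine Finset.sum_congr rfl fun i _ => ?_
  have e := contDiff_charFn ξ
  have hp := contDiff_pderiv hψ.1 i
  rw [pderiv_mul hψ.1 e, pderiv_charFn,
    pderiv_add (hp.mul e) (hψ.1.mul (contDiff_const.mul e)), pderiv_mul hp e,
    pderiv_mul hψ.1 (contDiff_const.mul e), pderiv_const_mul e, pderiv_charFn]
  ring

/-- The error is one order below the leading term, which has order `2(k+1)`. This gap is the source
of the gain in `FourierDecay.succ`. -/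
theorem isModulated_laplacian_iterate_sub {ψ : Rn n → ℂ} (hψ : IsCTest ψ) (k : ℕ) :
    IsModulated (2 * k + 1) (fun ξ x =>
      ((fun φ : Rn n → ℂ => Δ φ)^[k + 1] (fun y => ψ y * charFn ξ y)) x
        - lapSymbol ξ ^ (k + 1) * (ψ x * charFn ξ x)) := by
  induction k with
  | zero => simpa using isModulated_laplacian_sub hψ
  | succ k ih =>
    have h1 := ih.laplacian.mono (e := 2 * (k + 1) + 1) (by omega)
    have h2 := ((isModulated_laplacian_sub hψ).mul_symbol (norm_lapSymbol_pow_le (k + 1))).mono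
      (e := 2 * (k + 1) + 1) (by omega)
    -- With `g = ψ e_ξ` and `λ = lapSymbol ξ`, the new error is `Δ(Δ^(k+1) g - λ^(k+1) g) + λ^(k+1)
    -- (Δ g - λ g)`.
    convert IsModulated.add _ _ h1 h2 using 1
    ext ξ x
    have hψe : ContDiff ℝ ∞ (fun y => ψ y * charFn ξ y) := hψ.1.mul (contDiff_charFn ξ)
    have hit : ∀ m : ℕ, ContDiff ℝ ∞ ((fun φ : Rn n → ℂ => Δ φ)^[m] (fun y => ψ y * charFn ξ y)) := by
      intro m
      induction m with
      | zero => exact hψe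
      | succ m ihm => rw [Function.iterate_succ_apply']; exact contDiff_laplacian ihm
    have e1 : Δ (fun x => ((fun φ : Rn n → ℂ => Δ φ)^[k + 1] (fun y => ψ y * charFn ξ y)) x
        - lapSymbol ξ ^ (k + 1) * (ψ x * charFn ξ x)) x
        = Δ ((fun φ : Rn n → ℂ => Δ φ)^[k + 1] (fun y => ψ y * charFn ξ y)) x
          - lapSymbol ξ ^ (k + 1) * Δ (fun y => ψ y * charFn ξ y) x := by
      have h3 : ContDiffAt ℝ 2 (fun y => ψ y * charFn ξ y) x :=
        (contDiff_infty.1 hψe 2).contDiffAt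
      have h4 : ContDiffAt ℝ 2 ((fun φ : Rn n → ℂ => Δ φ)^[k + 1] (fun y => ψ y * charFn ξ y)) x :=
        (contDiff_infty.1 (hit (k + 1)) 2).contDiffAt
      have h5 := h4.laplacian_sub (h3.const_smul (lapSymbol ξ ^ (k + 1)))
      have h6 := InnerProductSpace.laplacian_smul (lapSymbol ξ ^ (k + 1)) h3
      rw [smul_eq_mul] at h6
      rw [← h6]
      exact h5
    rw [e1, Function.iterate_succ_apply' _ (k + 1)]
    ring

theorem contDiff_laplacian_iterate {f : Rn n → ℂ} (hf : ContDiff ℝ ∞ f) (k : ℕ) :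
    ContDiff ℝ ∞ ((fun φ : Rn n → ℂ => Δ φ)^[k] f) := by
  induction k with
  | zero => exact hf
  | succ k ih => rw [Function.iterate_succ_apply']; exact contDiff_laplacian ih

/-- Applied to real and imaginary parts, this extends a weak equation from real test functions to
modulated ones, which are complex. -/
theorem laplacian_iterate_clm_comp {f : Rn n → ℂ} (hf : ContDiff ℝ ∞ f) (L : ℂ →L[ℝ] ℝ) (k : ℕ) :
    (fun φ : Rn n → ℝ => Δ φ)^[k] (fun x => L (f x))
      = fun x => L ((fun φ : Rn n → ℂ => Δ φ)^[k] f x) := by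
  induction k with
  | zero => rfl
  | succ k ih =>
    rw [Function.iterate_succ_apply', Function.iterate_succ_apply', ih]
    ext x
    exact (contDiff_infty.1 (contDiff_laplacian_iterate hf k) 2).contDiffAt.laplacian_CLM_comp_left

theorem IsCTest.laplacian {φ : Rn n → ℂ} (hφ : IsCTest φ) : IsCTest (Δ φ) := by
  refine ⟨contDiff_laplacian hφ.1, HasCompactSupport.intro hφ.2.isCompact fun x hx => ?_⟩
  have h := InnerProductSpace.laplacian_congr_nhds (notMem_tsupport_iff_eventuallyEq.1 hx)
  have h0 : Δ (0 : Rn n → ℂ) = 0 := InnerProductSpace.laplacian_const (c := (0 : ℂ))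
  rw [h.eq_of_nhds, h0]
  rfl

theorem IsCTest.laplacian_iterate {φ : Rn n → ℂ} (hφ : IsCTest φ) (k : ℕ) :
    IsCTest ((fun φ : Rn n → ℂ => Δ φ)^[k] φ) := by
  induction k with
  | zero => exact hφ
  | succ k ih => rw [Function.iterate_succ_apply']; exact ih.laplacian

theorem IsCTest.clm_comp {φ : Rn n → ℂ} (hφ : IsCTest φ) (L : ℂ →L[ℝ] ℝ) :
    IsTest (fun x => L (φ x)) :=
  ⟨L.contDiff.comp hφ.1, hφ.2.comp_left (g := L) L.map_zero⟩

theorem IsCTest.integrable_mul {φ h : Rn n → ℂ} (hφ : IsCTest φ) (hh : LocallyIntegrable h) :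
    Integrable (fun x => h x * φ x) := by
  simpa [mul_comm] using hh.integrable_smul_left_of_hasCompactSupport hφ.1.continuous hφ.2

theorem IsTest.isCTest {φ : Rn n → ℝ} (hφ : IsTest φ) : IsCTest (fun x => (φ x : ℂ)) :=
  ⟨hφ.ofReal_contDiff, hφ.ofReal_hasCompactSupport⟩

theorem integral_mul_clm_decomp {φ h : Rn n → ℂ} (hφ : IsCTest φ) (hh : LocallyIntegrable h) :
    ∫ x, h x * φ x = (∫ x, h x * ((Complex.reCLM (φ x) : ℝ) : ℂ))
      + (∫ x, h x * ((Complex.imCLM (φ x) : ℝ) : ℂ)) * Complex.I := by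
  have h1 := ((hφ.clm_comp Complex.reCLM).isCTest).integrable_mul hh
  have h2 := ((hφ.clm_comp Complex.imCLM).isCTest).integrable_mul hh
  rw [← integral_mul_const, ← integral_add h1 (h2.mul_const _)]
  refine integral_congr_ae (Filter.Eventually.of_forall fun x => ?_)
  simp only [Complex.reCLM_apply, Complex.imCLM_apply]
  rw [mul_assoc, ← mul_add, Complex.re_add_im]

/-- A weak equation `Δ^k h = S` tested with complex test functions. -/
theorem integral_mul_laplacian_iterate_complex {k : ℕ} {h S : Rn n → ℂ}
    (hh : LocallyIntegrable h) (hS : LocallyIntegrable S)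
    (H : ∀ φ : Rn n → ℝ, IsTest φ →
      ∫ x, h x * (((fun ψ : Rn n → ℝ => Δ ψ)^[k] φ x : ℝ) : ℂ) = ∫ x, S x * (φ x : ℂ))
    {ψ : Rn n → ℂ} (hψ : IsCTest ψ) :
    ∫ x, h x * (fun ψ : Rn n → ℂ => Δ ψ)^[k] ψ x = ∫ x, S x * ψ x := by
  rw [integral_mul_clm_decomp (hψ.laplacian_iterate k) hh, integral_mul_clm_decomp hψ hS,
    ← H _ (hψ.clm_comp _), ← H _ (hψ.clm_comp _)]
  simp only [laplacian_iterate_clm_comp hψ.1]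

theorem IsCTest.mul_charFn {ψ : Rn n → ℂ} (hψ : IsCTest ψ) (ξ : Rn n) :
    IsCTest (fun x => ψ x * charFn ξ x) :=
  ⟨hψ.1.mul (contDiff_charFn ξ), hψ.2.mul_right⟩

theorem IsModulated.isCTest {d : ℕ} {F : Rn n → Rn n → ℂ} (hF : IsModulated d F) (ξ : Rn n) :
    IsCTest (F ξ) := by
  induction hF with
  | single c ψ hψ C hc =>
    exact ⟨contDiff_const.mul (hψ.mul_charFn ξ).1, (hψ.mul_charFn ξ).2.mul_left⟩
  | add F G _ _ hF hG => exact ⟨hF.1.add hG.1, hF.2.add hG.2⟩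

/-- The localised Fourier transforms of `h` decay of order `s`. -/
def FourierDecay (s : ℕ) (h : Rn n → ℂ) : Prop :=
  ∀ ψ : Rn n → ℂ, IsCTest ψ → ∃ C : ℝ, ∀ ξ, ‖∫ x, h x * (ψ x * charFn ξ x)‖ * wt s ξ ≤ C

theorem fourier_eq_integral_charFn (g : Rn n → ℂ) (ξ : Rn n) :
    𝓕 g ξ = ∫ x, g x * charFn ξ x := by
  rw [Real.fourier_eq]
  refine integral_congr_ae (Filter.Eventually.of_forall fun x => ?_)
  simp only [Circle.smul_def, smul_eq_mul, charFn]
  ring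

theorem FourierDecay.of_contDiff {S : Rn n → ℂ} (hS : ContDiff ℝ ∞ S) (s : ℕ) :
    FourierDecay s S := by
  intro ψ hψ
  let g : 𝓢(Rn n, ℂ) := (hψ.2.mul_left (f := S)).toSchwartzMap (hS.mul hψ.1)
  have h1 := fun ξ => SchwartzMap.one_add_le_sup_seminorm_apply (𝕜 := ℝ) (m := (s, 0))
    (k := s) (n := 0) le_rfl le_rfl (𝓕 g) ξ
  refine ⟨_, fun ξ => le_trans (le_of_eq ?_) (h1 ξ)⟩
  rw [norm_iteratedFDeriv_zero, SchwartzMap.fourier_coe, fourier_eq_integral_charFn, mul_comm]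
  simp only [← mul_assoc]
  rfl

theorem IsModulated.exists_bound {d s : ℕ} {F : Rn n → Rn n → ℂ} (hF : IsModulated d F)
    {h : Rn n → ℂ} (hh : LocallyIntegrable h) (hd : FourierDecay s h) :
    ∃ C : ℝ, ∀ ξ, ‖∫ x, h x * F ξ x‖ * wt s ξ ≤ C * wt d ξ := by
  induction hF with
  | single c ψ hψ B hc =>
    obtain ⟨C, hC⟩ := hd ψ hψ
    refine ⟨B * C, fun ξ => ?_⟩
    have e : ∫ x, h x * (c ξ * (ψ x * charFn ξ x)) = c ξ * ∫ x, h x * (ψ x * charFn ξ x) := by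
      rw [← integral_const_mul]
      refine integral_congr_ae (Filter.Eventually.of_forall fun x => ?_)
      ring
    rw [e, norm_mul, mul_assoc]
    calc ‖c ξ‖ * (‖∫ x, h x * (ψ x * charFn ξ x)‖ * wt s ξ) ≤ (B * wt d ξ) * C :=
          mul_le_mul (hc ξ) (hC ξ) (mul_nonneg (norm_nonneg _) (wt_pos s ξ).le)
            ((norm_nonneg _).trans (hc ξ))
      _ = _ := by ring
  | add F G hF hG hF' hG' =>
    obtain ⟨C, hC⟩ := hF'
    obtain ⟨D, hD⟩ := hG'
    refine ⟨C + D, fun ξ => ?_⟩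
    simp only [mul_add]
    rw [integral_add ((hF.isCTest ξ).integrable_mul hh) ((hG.isCTest ξ).integrable_mul hh)]
    have := mul_le_mul_of_nonneg_right (norm_add_le (∫ x, h x * F ξ x) (∫ x, h x * G ξ x))
      (wt_pos s ξ).le
    nlinarith [hC ξ, hD ξ]

theorem FourierDecay.zero {h : Rn n → ℂ} : FourierDecay 0 h := by
  intro ψ hψ
  refine ⟨∫ x, ‖h x * ψ x‖, fun ξ => ?_⟩
  rw [wt, pow_zero, mul_one]
  refine (norm_integral_le_integral_norm _).trans (le_of_eq ?_)
  refine integral_congr_ae (Filter.Eventually.of_forall fun x => ?_)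
  simp only [norm_mul, norm_charFn, mul_one]

theorem wt_le_norm_lapSymbol_pow (k : ℕ) {ξ : Rn n} (hξ : 1 ≤ ‖ξ‖) :
    wt (2 * k) ξ ≤ ‖lapSymbol ξ ^ k‖ := by
  rw [norm_pow, lapSymbol, Complex.norm_real, norm_neg, norm_pow,
    Real.norm_of_nonneg (by positivity), ← pow_mul, wt]
  refine pow_le_pow_left₀ (by positivity) ?_ _
  nlinarith [Real.pi_gt_three]

/-- A gain of one order of decay from the equation `Δ^(k+1) h = S`. -/
theorem FourierDecay.succ {k s : ℕ} {h S : Rn n → ℂ} (hh : LocallyIntegrable h)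
    (hS : ContDiff ℝ ∞ S)
    (H : ∀ ψ : Rn n → ℂ, IsCTest ψ →
      ∫ x, h x * (fun ψ : Rn n → ℂ => Δ ψ)^[k + 1] ψ x = ∫ x, S x * ψ x)
    (hd : FourierDecay s h) : FourierDecay (s + 1) h := by
  intro ψ hψ
  obtain ⟨C₀, h₀⟩ := hd ψ hψ
  obtain ⟨C₁, h₁⟩ := FourierDecay.of_contDiff hS s ψ hψ
  have hR := isModulated_laplacian_iterate_sub hψ k
  obtain ⟨C₂, h₂⟩ := hR.exists_bound hh hd
  have p₀ : 0 ≤ C₀ := (mul_nonneg (norm_nonneg _) (wt_pos s 0).le).trans (h₀ 0)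
  have p₁ : 0 ≤ C₁ := (mul_nonneg (norm_nonneg _) (wt_pos s 0).le).trans (h₁ 0)
  have p₂ : 0 ≤ C₂ := by
    have := (mul_nonneg (norm_nonneg _) (wt_pos s 0).le).trans (h₂ 0)
    simpa [wt] using this
  refine ⟨2 * C₀ + C₁ + C₂, fun ξ => ?_⟩
  set J := ∫ x, h x * (ψ x * charFn ξ x) with hJ
  have hw : wt (s + 1) ξ = wt s ξ * (1 + ‖ξ‖) := pow_succ _ _
  have hJ0 : 0 ≤ ‖J‖ * wt s ξ := mul_nonneg (norm_nonneg _) (wt_pos s ξ).le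
  rw [hw, ← mul_assoc]
  rcases le_total ‖ξ‖ 1 with hξ | hξ
  -- At low frequencies `1 + ‖ξ‖ ≤ 2`, whence the term `2 * C₀`.
  · nlinarith [h₀ ξ, norm_nonneg ξ]
  · have hc := hψ.mul_charFn ξ
    -- The equation tested with `ψ e_ξ`: `J` times a factor of size at least `(1 + ‖ξ‖)^(2k+2)`
    -- equals a rapidly decaying term minus an error whose coefficients grow with order `2k + 1`
    -- only.
    have key : lapSymbol ξ ^ (k + 1) * J = (∫ x, S x * (ψ x * charFn ξ x))
        - ∫ x, h x * ((fun φ : Rn n → ℂ => Δ φ)^[k + 1] (fun y => ψ y * charFn ξ y) x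
          - lapSymbol ξ ^ (k + 1) * (ψ x * charFn ξ x)) := by
      rw [← H _ hc, hJ, ← integral_const_mul, ← integral_sub
        ((hc.laplacian_iterate (k + 1)).integrable_mul hh) ((hR.isCTest ξ).integrable_mul hh)]
      refine integral_congr_ae (Filter.Eventually.of_forall fun x => ?_)
      ring
    have h3 : ‖lapSymbol ξ ^ (k + 1)‖ * (‖J‖ * wt s ξ) ≤ C₁ + C₂ * wt (2 * k + 1) ξ := by
      rw [← mul_assoc, ← norm_mul, key]
      refine (mul_le_mul_of_nonneg_right (norm_sub_le _ _) (wt_pos s ξ).le).trans ?_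
      rw [add_mul]
      exact add_le_add (h₁ ξ) (h₂ ξ)
    have h4 := mul_le_mul_of_nonneg_right (wt_le_norm_lapSymbol_pow (k + 1) hξ) hJ0
    have hw2 : wt (2 * (k + 1)) ξ = wt (2 * k + 1) ξ * (1 + ‖ξ‖) := pow_succ _ _
    have hw1 := one_le_wt (2 * k + 1) ξ
    have h5 : wt (2 * k + 1) ξ * (‖J‖ * wt s ξ * (1 + ‖ξ‖)) ≤ wt (2 * k + 1) ξ * (C₁ + C₂) := by
      rw [hw2] at h4
      nlinarith
    linarith [le_of_mul_le_mul_left h5 (by linarith)]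

theorem exists_contDiff_of_fourierDecay {h : Rn n → ℂ} (hh : LocallyIntegrable h)
    (hd : ∀ s, FourierDecay s h) : ∃ v : Rn n → ℂ, ContDiff ℝ ∞ v ∧ h =ᵐ[volume] v := by
  refine exists_contDiff_of_forall_ball fun R => ?_
  obtain ⟨χ, hχ, h1, -⟩ := exists_isTest_ball (n := n) (r := R + 1) (R := R + 2)
    (by positivity) (by linarith)
  set g : Rn n → ℂ := fun x => h x * (χ x : ℂ) with hg
  have hgi : Integrable g := hχ.isCTest.integrable_mul hh
  have hA : ∀ s, Integrable (fun ξ => wt s ξ * ‖𝓕 g ξ‖) := fun s => by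
    -- The `n + 1` extra orders of decay pay for integrability over `ℝⁿ`.
    obtain ⟨C, hC⟩ := hd (s + (n + 1)) _ hχ.isCTest
    have hr : ((Module.finrank ℝ (Rn n) : ℕ) : ℝ) < (n : ℝ) + 1 := by simp
    refine ((integrable_one_add_norm (μ := (volume : Measure (Rn n))) hr).const_mul C).mono'
      ((continuous_wt s).mul (continuous_fourier hgi).norm).aestronglyMeasurable
      (Filter.Eventually.of_forall fun ξ => ?_)
    have hp : 0 < (1 + ‖ξ‖) ^ ((n : ℝ) + 1) := by positivity
    have h2 := hC ξ
    rw [Real.norm_of_nonneg (mul_nonneg (wt_pos s ξ).le (norm_nonneg _)), Real.rpow_neg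
      (by positivity), ← div_eq_mul_inv, le_div_iff₀ hp, fourier_eq_integral_charFn]
    have e : (1 + ‖ξ‖) ^ ((n : ℝ) + 1) = (1 + ‖ξ‖) ^ (n + 1) := by
      exact_mod_cast Real.rpow_natCast (1 + ‖ξ‖) (n + 1)
    have e2 : wt (s + (n + 1)) ξ = wt s ξ * (1 + ‖ξ‖) ^ (n + 1) := pow_add _ _ _
    rw [e2] at h2
    simp only [hg, mul_assoc] at h2 ⊢
    rw [e]
    linarith
  have hF := continuous_fourier hgi
  have hM : ∀ s, MemA s (𝓕⁻ (𝓕 g)) := fun s => .of_fourierInv hF.aestronglyMeasurable (hA s)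
  have hFi : Integrable (𝓕 g) := by
    refine (hA 0).mono' hF.aestronglyMeasurable (Filter.Eventually.of_forall fun ξ => ?_)
    simp [wt]
  refine ⟨𝓕⁻ (𝓕 g), contDiff_infty.2 fun s => (hM s).contDiff, ?_⟩
  filter_upwards [fourierInv_fourier_ae_eq hgi hFi] with x hx hxR
  rw [← hx, hg]
  simp [h1 x (Metric.ball_subset_ball (by linarith) hxR)]

/-- Weyl's lemma for powers of the Laplacian with smooth right-hand side. -/
theorem exists_contDiff_of_weak_laplacian_iterate {k : ℕ} {h S : Rn n → ℂ}
    (hh : LocallyIntegrable h) (hS : ContDiff ℝ ∞ S)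
    (H : ∀ φ : Rn n → ℝ, IsTest φ →
      ∫ x, h x * (((fun ψ : Rn n → ℝ => Δ ψ)^[k] φ x : ℝ) : ℂ) = ∫ x, S x * (φ x : ℂ)) :
    ∃ v : Rn n → ℂ, ContDiff ℝ ∞ v ∧ h =ᵐ[volume] v := by
  cases k with
  | zero =>
    refine ⟨S, hS, ae_eq_of_integral_contDiff_smul_eq hh hS.continuous.locallyIntegrable
      fun φ h1 h2 => ?_⟩
    simpa [mul_comm] using H φ ⟨h1, h2⟩
  | succ k =>
    refine exists_contDiff_of_fourierDecay hh fun s => ?_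
    induction s with
    | zero => exact .zero
    | succ s ih =>
      exact ih.succ hh hS fun ψ hψ =>
        integral_mul_laplacian_iterate_complex hh hS.continuous.locallyIntegrable H hψ

/-! ### From the Sobolev sense to the integral equation -/

theorem ofReal_laplacian_iterate {φ : Rn n → ℝ} (hφ : IsTest φ) (k : ℕ) :
    (fun f : Rn n → ℂ => Δ f)^[k] (fun x => (φ x : ℂ))
      = fun x => (((fun f : Rn n → ℝ => Δ f)^[k] φ x : ℝ) : ℂ) := by
  induction k with
  | zero => rfl
  | succ k ih =>
    rw [Function.iterate_succ_apply', Function.iterate_succ_apply', ih]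
    have h : ContDiff ℝ ∞ ((fun f : Rn n → ℝ => Δ f)^[k] φ) := by
      have h1 := laplacian_iterate_clm_comp hφ.ofReal_contDiff Complex.reCLM k
      simp only [Complex.reCLM_apply, Complex.ofReal_re] at h1
      have h2 : (fun f : Rn n → ℝ => Δ f)^[k] φ
          = fun x => ((fun f : Rn n → ℂ => Δ f)^[k] (fun x => (φ x : ℂ)) x).re := h1
      rw [h2]
      exact Complex.reCLM.contDiff.comp (contDiff_laplacian_iterate hφ.ofReal_contDiff k)
    ext x
    exact (contDiff_infty.1 h 2).contDiffAt.laplacian_CLM_comp_left (l := Complex.ofRealCLM)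

theorem fourier_laplacian (f : 𝓢(Rn n, ℂ)) (ξ : Rn n) :
    𝓕 ((Δ f : 𝓢(Rn n, ℂ)) : Rn n → ℂ) ξ = lapSymbol ξ * 𝓕 (f : Rn n → ℂ) ξ := by
  have ht : (fun x : Rn n => ‖x‖ ^ 2).HasTemperateGrowth := by fun_prop
  rw [← SchwartzMap.fourier_coe, SchwartzMap.laplacian_eq_fourierMultiplierCLM,
    SchwartzMap.fourierMultiplierCLM_apply, FourierTransform.fourier_smul,
    FourierTransform.fourier_fourierInv_eq, smul_apply,
    SchwartzMap.smulLeftCLM_apply_apply ht, SchwartzMap.fourier_coe, smul_smul, lapSymbol,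
    Complex.real_smul]
  push_cast
  ring

theorem coe_laplacian_iterate (f : 𝓢(Rn n, ℂ)) (k : ℕ) :
    (((fun f : 𝓢(Rn n, ℂ) => Δ f)^[k] f : 𝓢(Rn n, ℂ)) : Rn n → ℂ)
      = (fun f : Rn n → ℂ => Δ f)^[k] f := by
  induction k with
  | zero => rfl
  | succ k ih =>
    rw [Function.iterate_succ_apply', Function.iterate_succ_apply', ← ih]
    ext x
    exact SchwartzMap.laplacian_apply _ x

theorem fourier_laplacian_iterate (f : 𝓢(Rn n, ℂ)) (k : ℕ) (ξ : Rn n) :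
    𝓕 (((fun f : 𝓢(Rn n, ℂ) => Δ f)^[k] f : 𝓢(Rn n, ℂ)) : Rn n → ℂ) ξ
      = lapSymbol ξ ^ k * 𝓕 (f : Rn n → ℂ) ξ := by
  induction k with
  | zero => simp
  | succ k ih => rw [Function.iterate_succ_apply', fourier_laplacian, ih]; ring

theorem highSymbol_mul_lapSymbol_pow (k : ℕ) (ξ : Rn n) :
    (highSymbol (2 * k + 1) ξ : ℂ) * lapSymbol ξ ^ k = (-1) ^ k * highSymbol 1 ξ := by
  have h : highSymbol (2 * k + 1) ξ * ((2 * Real.pi * ‖ξ‖) ^ 2) ^ k = highSymbol 1 ξ := by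
    rw [highSymbol, highSymbol, rieszSymbol, rieszSymbol]
    rcases eq_or_ne ξ 0 with rfl | hξ
    · simp [cutoff_eq_one]
    · have hp : 0 < 2 * Real.pi * ‖ξ‖ := by have := norm_pos_iff.2 hξ; positivity
      rw [mul_right_comm, ← pow_mul, ← Real.rpow_natCast (2 * Real.pi * ‖ξ‖), ← Real.rpow_add hp]
      congr 2
      push_cast
      ring
  rw [← h, lapSymbol]
  push_cast
  rw [neg_pow]
  ring

/-- On the Fourier side `Δ^k` cancels `2k` orders of the kernel's symbol, up to sign, so the kernel
of order `2k + 1` becomes that of order `1`. -/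
theorem integral_highKernel_mul_laplacian_iterate {φ : Rn n → ℝ} (hφ : IsTest φ) (k : ℕ)
    (x : Rn n) :
    ∫ y, highKernel (2 * k + 1) (x - y) * (((fun f : Rn n → ℝ => Δ f)^[k] φ y : ℝ) : ℂ)
      = (-1) ^ k * ∫ y, highKernel 1 (x - y) * (φ y : ℂ) := by
  have hk : (0 : ℝ) < 2 * k + 1 := by positivity
  have h1 := integral_kernel_mul_schwartz (integrable_highKernel (n := n) hk)
    ((fun f : 𝓢(Rn n, ℂ) => Δ f)^[k] hφ.toSchwartz) x
  have h2 := integral_kernel_mul_schwartz (integrable_highKernel (n := n) one_pos) hφ.toSchwartz x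
  rw [coe_laplacian_iterate] at h1
  have e : (hφ.toSchwartz : Rn n → ℂ) = fun x => (φ x : ℂ) := rfl
  rw [e, ofReal_laplacian_iterate hφ] at h1
  refine h1.trans ?_
  rw [e] at h2
  rw [h2, ← fourierInv_const_mul]
  refine congrArg (fun F : Rn n → ℂ => 𝓕⁻ F x) (funext fun ξ => ?_)
  rw [← ofReal_laplacian_iterate hφ, ← e, ← coe_laplacian_iterate, fourier_laplacian_iterate,
    fourier_highKernel hk, fourier_highKernel one_pos, ← mul_assoc, ← mul_assoc,
    highSymbol_mul_lapSymbol_pow]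

theorem IsTest.laplacian_iterate {φ : Rn n → ℝ} (hφ : IsTest φ) (k : ℕ) :
    IsTest ((fun f : Rn n → ℝ => Δ f)^[k] φ) := by
  have h := (hφ.isCTest.laplacian_iterate k).clm_comp Complex.reCLM
  rw [ofReal_laplacian_iterate hφ] at h
  exact h

theorem IsTest.exists_norm_ofReal_le {φ : Rn n → ℝ} (hφ : IsTest φ) :
    ∃ C, ∀ x, ‖(φ x : ℂ)‖ ≤ C := by
  obtain ⟨C, hC⟩ := hφ.1.continuous.bounded_above_of_compact_support hφ.2
  exact ⟨C, fun x => by simpa using hC x⟩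

theorem locallyIntegrable_complex_ofReal {u : Rn n → ℝ} (hu : LocallyIntegrable u) :
    LocallyIntegrable (fun x => (u x : ℂ)) := fun x => by
  obtain ⟨U, hU, hi⟩ := hu x
  exact ⟨U, hU, hi.ofReal⟩

/-- The parametrix representation of a function with prescribed weak Laplacian power. -/
theorem exists_contDiff_add_conv_of_weakLaplacianPow {k : ℕ} {u w f : Rn n → ℝ} {S : Rn n → ℂ}
    (hu : LocallyIntegrable u) (hw : HasWeakLaplacianPow k u w) (hf : Integrable f)
    (hS : ContDiff ℝ ∞ S)
    (h : ∀ᵐ x, (((-1) ^ k * w x : ℝ) : ℂ) = S x + ∫ y, highKernel 1 (x - y) * (f y : ℂ)) :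
    ∃ v : Rn n → ℂ, ContDiff ℝ ∞ v ∧
      ∀ᵐ x, (u x : ℂ) = v x + ∫ y, highKernel (2 * k + 1) (x - y) * (f y : ℂ) := by
  have hk : (0 : ℝ) < 2 * k + 1 := by positivity
  have hf' := integrable_complex_ofReal hf
  have hKf := integrable_conv (integrable_highKernel (n := n) hk) hf'
  have hK1f := integrable_conv (integrable_highKernel (n := n) one_pos) hf'
  have huc := locallyIntegrable_complex_ofReal hu
  have hsq : ((-1 : ℂ) ^ k) * (-1) ^ k = 1 := by rw [← mul_pow]; simp
  -- The difference `u - K_{2k+1} * f` has weak `Δ^k` equal to `(-1)^k S`: applying `Δ^k` to the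
  -- potential gives `(-1)^k K_1 * f`, which cancels the potential part of `w`.
  obtain ⟨v, hv, hae⟩ := exists_contDiff_of_weak_laplacian_iterate (k := k)
    (S := fun x => (-1) ^ k * S x)
    (huc.sub hKf.locallyIntegrable) (contDiff_const.mul hS) fun φ hφ => by
      have hφk := hφ.laplacian_iterate k
      obtain ⟨C, hC⟩ := hφ.exists_norm_ofReal_le
      obtain ⟨D, hD⟩ := hφk.exists_norm_ofReal_le
      have i1 := integral_mul_conv_comm (K := highKernel (2 * k + 1)) (f := fun x => (f x : ℂ))
        (highKernel_neg _) (integrable_test_mul_conv (integrable_highKernel hk) hf'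
          hφk.isCTest.1.continuous hD)
      have i2 := integral_mul_conv_comm (K := highKernel 1) (f := fun x => (f x : ℂ))
        (highKernel_neg _) (integrable_test_mul_conv (integrable_highKernel one_pos) hf'
          hφ.isCTest.1.continuous hC)
      simp only [integral_highKernel_mul_laplacian_iterate hφ] at i1
      have i3 : ∫ y, (f y : ℂ) * ((-1) ^ k * ∫ x, highKernel 1 (y - x) * (φ x : ℂ))
          = (-1) ^ k * ∫ y, (f y : ℂ) * ∫ x, highKernel 1 (y - x) * (φ x : ℂ) := by
        rw [← integral_const_mul]
        refine integral_congr_ae (Filter.Eventually.of_forall fun x => ?_)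
        ring
      have i4 : ∫ x, (u x : ℂ) * (((fun f : Rn n → ℝ => Δ f)^[k] φ x : ℝ) : ℂ)
          = ∫ x, (-1) ^ k * (S x * (φ x : ℂ))
            + (-1) ^ k * ((φ x : ℂ) * ∫ y, highKernel 1 (x - y) * (f y : ℂ)) := by
        have := congrArg (fun r : ℝ => (r : ℂ)) (hw φ hφ)
        simp only [← integral_complex_ofReal, Complex.ofReal_mul] at this
        rw [this]
        refine integral_congr_ae ?_
        filter_upwards [h] with x hx
        push_cast at hx
        linear_combination (-1) ^ k * (φ x : ℂ) * hx - (w x : ℂ) * φ x * hsq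
      have i5 := integral_sub (hφk.isCTest.integrable_mul huc)
        (hφk.isCTest.integrable_mul hKf.locallyIntegrable)
      have i6 : Integrable (fun x => (φ x : ℂ) * ∫ y, highKernel 1 (x - y) * (f y : ℂ)) := by
        simpa [mul_comm] using hφ.isCTest.integrable_mul hK1f.locallyIntegrable
      have i7 := hφ.isCTest.integrable_mul hS.continuous.locallyIntegrable
      simp only [Pi.sub_apply, sub_mul, mul_assoc]
      rw [i5, i4, integral_add (i7.const_mul _) (i6.const_mul _), integral_const_mul,
        integral_const_mul]
      have i8 : ∫ x, (∫ y, highKernel (2 * k + 1) (x - y) * (f y : ℂ))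
          * (((fun f : Rn n → ℝ => Δ f)^[k] φ x : ℝ) : ℂ)
          = (-1) ^ k * ∫ x, (φ x : ℂ) * ∫ y, highKernel 1 (x - y) * (f y : ℂ) := by
        rw [i2, ← i3, ← i1]
        refine integral_congr_ae (Filter.Eventually.of_forall fun x => ?_)
        exact mul_comm _ _
      rw [i8]
      ring
  refine ⟨v, hv, ?_⟩
  filter_upwards [hae] with x hx
  rw [← hx]
  simp

/-! ### Conclusion in the two senses -/

theorem IsDistributionalSolution.isSmooth {u : Rn n → ℝ} {C : ℝ} (hn : 1 ≤ n) (hC : 0 ≤ C)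
    (hf : Integrable fun x => C * Real.exp (n * u x))
    (hu : IsDistributionalSolution u (distributionOf _ hf)) : IsSmooth u := by
  have hn0 : (0 : ℝ) < n := by exact_mod_cast hn
  obtain ⟨hu, h⟩ := hu
  simp only [distributionOf_apply] at h
  obtain ⟨S, hS, hae⟩ := exists_contDiff_add_conv (by positivity) hu hf h
  rw [show 2 * ((n : ℝ) / 2) = n by ring] at hae
  exact (isLogKernel_highKernel hn).isSmooth_of_eq_add_conv_exp hn hS hC hn0.le hf hae

/-- The parametrix is applied twice: with `s = 1/2` to the function `(-1)^k w`, then, through Weyl's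
lemma, to `u` itself with the kernel of order `2k + 1 = n`. -/
theorem IsSobolevSolution.isSmooth {u : Rn n → ℝ} {C : ℝ} (hn : Odd n) (hC : 0 ≤ C)
    (hf : Integrable fun x => C * Real.exp (n * u x))
    (hu : IsSobolevSolution u (distributionOf _ hf)) : IsSmooth u := by
  obtain ⟨hu, w, hw, hwL, h⟩ := hu
  simp only [distributionOf_apply] at h
  obtain ⟨k, hk⟩ := hn
  rw [show (n - 1) / 2 = k by omega] at hw h
  have hL : MemL (1 / 2) (fun x => (-1) ^ k * w x) :=
    ⟨hwL.1.smul ((-1 : ℝ) ^ k), by simpa [abs_mul] using hwL.2⟩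
  obtain ⟨S, hS, hae⟩ := exists_contDiff_add_conv (by norm_num) hL hf h
  rw [show (2 : ℝ) * (1 / 2) = 1 by norm_num] at hae
  obtain ⟨v, hv, hae'⟩ := exists_contDiff_add_conv_of_weakLaplacianPow hu.1 hw hf hS hae
  rw [show (2 : ℝ) * k + 1 = n by rw [hk]; push_cast; ring] at hae'
  have hn1 : 1 ≤ n := by omega
  exact (isLogKernel_highKernel hn1).isSmooth_of_eq_add_conv_exp hn1 hv hC n.cast_nonneg hf hae'

end ConformalQ

theorem mainTheorem3 (n : ℕ) (hn : 1 ≤ n) (u : ConformalQ.Rn n → ℝ)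
    (hV : MeasureTheory.Integrable (fun x => Real.exp ((n : ℝ) * u x)) MeasureTheory.volume) :
    (ConformalQ.IsDistributionalSolution u
        (ConformalQ.distributionOf
          (fun x => ((n - 1).factorial : ℝ) * Real.exp ((n : ℝ) * u x)) (hV.const_mul _)) →
      ConformalQ.IsSmooth u) ∧
    (Odd n →
      ConformalQ.IsSobolevSolution u
        (ConformalQ.distributionOf
          (fun x => ((n - 1).factorial : ℝ) * Real.exp ((n : ℝ) * u x)) (hV.const_mul _)) →
      ConformalQ.IsSmooth u) :=
  ⟨fun hu => hu.isSmooth hn (Nat.cast_nonneg _),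
    fun hodd hu => hu.isSmooth hodd (Nat.cast_nonneg _)⟩
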